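/- Let $\mu$ be Lebesgue measure on $\mathbb R$, $\|\cdot\|$ the $L_1(\mu)$-norm, and $d(P,Q)=\sup_{A}[P(A)-Q(A)]$ (supremum over Borel sets $A$) the total variation distance. For a nonempty finite set $A\subset\mathbb R$ let $\mathbf I(A)$ be the set of the $|A|+1$ open intervals into which $A$ cuts $\mathbb R$. For $k\ge 2$, let $\overline{\mathcal M}_k$ be the set of probability densities on $\mathbb R$ that are monotone (nondecreasing or nonincreasing) on each $I\in\mathbf I(A)$ for some $A$ with $1\le|A|\le k-1$. For $D\ge1$, let $\overline{\mathcal O}_{D,k}$ be the set of those $p\in\overline{\mathcal M}_k$ that are constant on each $I\in\mathbf I(A)$ for some $A$ with $1\le|A|\le D+1$. Let $\mathcal M_k$ be a countable $L_1$-dense subset of $\overline{\mathcal M}_k$ that contains, for every $D\ge 1$, a countable $L_1$-dense subset of $\overline{\mathcal O}_{D,k}$. Let $n\ge1$ and $\varepsilon>0$. For $\mathbf x\in\mathbb R^n$, $p,q\in\mathcal M_k$ and $P=p\cdot\mu$, put $$\mathbf T(\mathbf x,p,q)=\sum_{i=1}^n\big[\mathbf 1_{q>p}(x_i)-P(q>p)\big],\qquad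 \mathbf T(\mathbf x,p)=\sup_{q\in\mathcal M_k}\mathbf T(\mathbf x,p,q).$$ A TV-estimator on $\mathcal M_k$ is a measurable choice $\widehat p=\widehat p(\mathbf x)\in\mathcal M_k$ with $\mathbf T(\mathbf x,\widehat p)\le\inf_{p'\in\mathcal M_k}\mathbf T(\mathbf x,p')+\varepsilon$ for all $\mathbf x$; write $\widehat P=\widehat p\cdot\mu$. Let $X_1,\dots,X_n$ be independent real random variables with arbitrary laws $P_1^\star,\dots,P_n^\star$, let $P^\star=n^{-1}\sum_{i=1}^nP_i^\star$, and let $\widehat p=\widehat p(X_1,\dots,X_n)$ be any TV-estimator on $\mathcal M_k$. (1) For every $k\ge2$, $$\mathbb E\big[d(P^\star,\widehat P)\big]\le\inf_{D\ge1}\Big[3\inf_{q\in\overline{\mathcal O}_{D,k}}d(P^\star,q\cdot\mu)+83.2\sqrt{\frac{D+k+1}{n}}\,\Big]+\frac{\varepsilon}{n}.$$ (2) Let $k\ge3$ and $R>0$. Assume that $X_1,\dots,X_n$ are i.i.d. with a density $p\in\overline{\mathcal M}_k^\infty(R)$, meaning that $p\in\overline{\mathcal M}_k$, that $p$ can be written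 almost everywhere as $$p=\sum_{i=1}^{k-2}w_ip_i\mathbf 1_{(x_{i-1},x_i)}$$ where $x_0<x_1<\dots<x_{k-2}$ are real numbers, $w_i\ge0$, $\sum_iw_i=1$, and each $p_i$ is a density vanishing outside $I_i=(x_{i-1},x_i)$, monotone on $I_i$, with $V_i=\sup_{I_i}p_i-\inf_{I_i}p_i<\infty$, and that, with $L_i=x_i-x_{i-1}$, the infimum of $\big[\sum_{i=1}^{k-2}\sqrt{w_i\log(1+L_iV_i)}\,\big]^2$ over all such representations of $p$ is less than $R$. Then $$\mathbb E\big[\|p-\widehat p\|\big]\le82.6\Big(\frac Rn\Big)^{1/3}+166.4\sqrt{\frac{2k}{n}}+\frac{2\varepsilon}{n}.$$ -/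

import Mathlib

open MeasureTheory ProbabilityTheory

noncomputable section

namespace TVMonotone

/-- A probability density on the real line (with respect to Lebesgue measure). -/
structure IsDensity (p : ℝ → ℝ) : Prop where
  measurable : Measurable p
  nonneg : ∀ x, 0 ≤ p x
  lintegral_eq_one : ∫⁻ x, ENNReal.ofReal (p x) = 1

/-- The measure `p · μ`, with `μ` the Lebesgue measure. -/
def densityMeasure (p : ℝ → ℝ) : Measure ℝ :=
  volume.withDensity (fun x => ENNReal.ofReal (p x))

/-- The `L¹`-distance of two densities. -/
def l1Dist (p q : ℝ → ℝ) : ℝ := ∫ x, |p x - q x|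

/-- The total variation distance of two probability measures: the supremum of `P A - Q A`
over all measurable sets `A`. -/
def tvDist (P Q : Measure ℝ) : ℝ :=
  ⨆ A : {A : Set ℝ // MeasurableSet A}, (P.real A.1 - Q.real A.1)

/-- `𝒜(m)`: the nonempty subsets of `ℝ` with at most `m` elements. -/
def cutSets (m : ℕ) : Set (Finset ℝ) := {A | A.Nonempty ∧ A.card ≤ m}

/-- `𝐈(A)`: the open intervals into which the points of `A` cut the real line. -/
def openPieces (A : Finset ℝ) : Set (Set ℝ) :=
  {I | (∃ a ∈ A, (∀ b ∈ A, a ≤ b) ∧ I = Set.Iio a) ∨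
    (∃ a ∈ A, ∃ b ∈ A, a < b ∧ (∀ c ∈ A, c ∉ Set.Ioo a b) ∧ I = Set.Ioo a b) ∨
    (∃ a ∈ A, (∀ b ∈ A, b ≤ a) ∧ I = Set.Ioi a)}

/-- `g` is nondecreasing on `I` or nonincreasing on `I`. -/
def IsMonotoneOn (g : ℝ → ℝ) (I : Set ℝ) : Prop := MonotoneOn g I ∨ AntitoneOn g I

/-- `g` is `k`-piecewise monotone. -/
def IsPiecewiseMonotone (k : ℕ) (g : ℝ → ℝ) : Prop :=
  ∃ A ∈ cutSets (k - 1), ∀ I ∈ openPieces A, IsMonotoneOn g I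

/-- The `k`-piecewise monotone densities. -/
def monotoneDensities (k : ℕ) : Set (ℝ → ℝ) :=
  {p | IsDensity p ∧ IsPiecewiseMonotone k p}

/-- The `k`-piecewise monotone densities that are constant on each element of `𝐈(A)`, for some
`A` with at most `D + 1` elements. -/
def stepDensities (D k : ℕ) : Set (ℝ → ℝ) :=
  {p | p ∈ monotoneDensities k ∧
    ∃ A ∈ cutSets (D + 1), ∀ I ∈ openPieces A, ∃ c : ℝ, ∀ x ∈ I, p x = c}

/-- `S` is a countable subset of `T` that is dense in `T` for the `L¹`-distance. -/
structure IsCountableDenseIn (S T : Set (ℝ → ℝ)) : Prop where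
  subset : S ⊆ T
  countable : S.Countable
  dense : ∀ p ∈ T, ∀ δ > 0, ∃ q ∈ S, l1Dist p q < δ

/-- `M` may serve as the model `𝓜ₖ`: a countable dense subset of the set of `k`-piecewise
monotone densities that contains, for every `D ≥ 1`, a countable dense subset of the set of
step densities with index `D`. -/
structure IsCountableModel (k : ℕ) (M : Set (ℝ → ℝ)) : Prop where
  isCountableDenseIn : IsCountableDenseIn M (monotoneDensities k)
  contains_dense_steps : ∀ D : ℕ, 1 ≤ D →
    ∃ O : Set (ℝ → ℝ), O ⊆ M ∧ IsCountableDenseIn O (stepDensities D k)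

/-- `𝐓(𝐱, P, Q) = ∑ᵢ (1_{q > p}(xᵢ) - P(q > p))` for `P = p · μ`, `Q = q · μ`. -/
def testStat {n : ℕ} (x : Fin n → ℝ) (p q : ℝ → ℝ) : ℝ :=
  ∑ i, (Set.indicator {y | p y < q y} (fun _ => (1 : ℝ)) (x i)
    - (densityMeasure p).real {y | p y < q y})

/-- `𝐓(𝐱, P) = sup_{Q} 𝐓(𝐱, P, Q)`, the supremum being taken over the model `M`. -/
def supTestStat (M : Set (ℝ → ℝ)) {n : ℕ} (x : Fin n → ℝ) (p : ℝ → ℝ) : ℝ :=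
  ⨆ q : M, testStat x p q.1

/-- `phat` is a TV-estimator on `M` with parameter `ε`: a measurable choice, for every sample
`x`, of an `ε`-minimizer of `P ↦ 𝐓(𝐱, P)` over the model `M`. Measurability is that of the
random probability measure `phat x · μ`. -/
structure IsTVEstimator (M : Set (ℝ → ℝ)) (ε : ℝ) {n : ℕ} (phat : (Fin n → ℝ) → ℝ → ℝ) :
    Prop where
  measurable : Measurable (fun x => densityMeasure (phat x))
  mem : ∀ x, phat x ∈ M
  le_iInf_add : ∀ x, supTestStat M x (phat x) ≤ (⨅ p' : M, supTestStat M x p'.1) + ε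

/-- A way of writing `p`, almost everywhere, as `∑ᵢ wᵢ pᵢ 1_{(xᵢ₋₁, xᵢ)}` with `m` terms:
`x₀ < ⋯ < xₘ`, the `wᵢ` nonnegative with sum one, and `pᵢ` a monotone density on
`(xᵢ₋₁, xᵢ)` (in particular zero outside that interval) with finite variation there. -/
structure MonotoneMixture (m : ℕ) (p : ℝ → ℝ) where
  x : Fin (m + 1) → ℝ
  w : Fin m → ℝ
  f : Fin m → ℝ → ℝ
  strictMono_x : StrictMono x
  w_nonneg : ∀ i, 0 ≤ w i
  sum_w : ∑ i, w i = 1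
  isDensity_f : ∀ i, IsDensity (f i)
  f_eq_zero : ∀ i, ∀ y, y ∉ Set.Ioo (x i.castSucc) (x i.succ) → f i y = 0
  isMonotoneOn_f : ∀ i, IsMonotoneOn (f i) (Set.Ioo (x i.castSucc) (x i.succ))
  bddAbove_f : ∀ i, BddAbove (f i '' Set.Ioo (x i.castSucc) (x i.succ))
  ae_eq : p =ᵐ[volume] fun y =>
    ∑ i, w i * Set.indicator (Set.Ioo (x i.castSucc) (x i.succ)) (f i) y

/-- The length `Lᵢ` of the interval `(xᵢ₋₁, xᵢ)`. -/
def MonotoneMixture.len {m : ℕ} {p : ℝ → ℝ} (r : MonotoneMixture m p) (i : Fin m) : ℝ :=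
  r.x i.succ - r.x i.castSucc

/-- The variation `Vᵢ` of `pᵢ` on the interval `(xᵢ₋₁, xᵢ)`. -/
def MonotoneMixture.var {m : ℕ} {p : ℝ → ℝ} (r : MonotoneMixture m p) (i : Fin m) : ℝ :=
  sSup (r.f i '' Set.Ioo (r.x i.castSucc) (r.x i.succ))
    - sInf (r.f i '' Set.Ioo (r.x i.castSucc) (r.x i.succ))

/-- `(∑ᵢ √(wᵢ log (1 + Lᵢ Vᵢ)))²`. -/
def MonotoneMixture.cost {m : ℕ} {p : ℝ → ℝ} (r : MonotoneMixture m p) : ℝ :=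
  (∑ i, Real.sqrt (r.w i * Real.log (1 + r.len i * r.var i))) ^ 2

/-- The `k`-piecewise monotone densities that admit a representation with `k - 2` terms. -/
def boundedMonotoneDensities (k : ℕ) : Set (ℝ → ℝ) :=
  {p | p ∈ monotoneDensities k ∧ Nonempty (MonotoneMixture (k - 2) p)}

/-- `R_{k,0}(p)`, the infimum of the cost over all representations of `p`. -/
def complexity (k : ℕ) (p : ℝ → ℝ) : ℝ := ⨅ r : MonotoneMixture (k - 2) p, r.cost

/-- The elements of `boundedMonotoneDensities k` with `R_{k,0}(p) < R`. -/
def boundedMonotoneDensitiesLT (k : ℕ) (R : ℝ) : Set (ℝ → ℝ) :=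
  {p | p ∈ boundedMonotoneDensities k ∧ complexity k p < R}

/-- `P⋆ = n⁻¹ ∑ᵢ Pᵢ⋆`, the uniform mixture of the laws of the observations. -/
def meanLaw {Ω : Type*} [MeasurableSpace Ω] (ν : Measure Ω) {n : ℕ} (X : Fin n → Ω → ℝ) :
    Measure ℝ :=
  (n : ENNReal)⁻¹ • ∑ i, ν.map (X i)

end TVMonotone

end

/-! The argument compares the estimator with a step density `pbar` of the model and then
approximates the target by step densities.

Deterministic part (`IsTVEstimator.mul_tvDist_le`). The distance from `pbar` to the estimate is
attained on the set where the estimate lies below `pbar`, so it is read off the test statistic up to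
a bias d(P⋆, pbar) and a fluctuation. Near-minimality bounds that statistic by the supremum of the
tests at `pbar`, at the price of another bias and another fluctuation. The triangle inequality adds
a third bias, whence the factor 3. Both fluctuations are suprema of centred empirical processes over
the sets {pbar < q} and {pbar ≤ q}.

Fluctuations. Cut the line at the D + 1 points of `pbar` and the k - 1 points of q. On each
resulting cell `pbar` is constant and q is monotone, so the set is convex on each of at most m = 2(D
+ k) + 1 cells, points included. After symmetrization it remains to bound the mean of the supremum
of the signed count over such sets (`sum_iSup_sgn_indicator_le`). Along the sorted sample, such a
set is a player who joins a random walk at most m times. If each entry costs h, the best net gain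
obeys a two-state recursion, and a quadratic potential shows that its mean is at most n / (2h).
Refunding the entries costs hm, and h = √(n/m) gives a bound of order √(nm) without entropy or
combinatorial dimension. The resulting constant 12 is well below 83.2.

Approximation. A bounded monotone density on an interval is averaged over N parts whose lengths grow
geometrically (`exists_step_approx`); the L¹ error is of order log(1 + LV) / N. Sharing the parts
among the components of the mixture in proportion to √(wᵢ log(1 + LᵢVᵢ)) gives error 4u with about
R/u parts, and u = (R/n)^(1/3) balances this against √(D/n). -/

noncomputable section

namespace TVMonotone

/-! ### Optimal stopping of a random walk with a cost for each entry -/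

/-- The sign attached to a Boolean. -/
def sgn (b : Bool) : ℝ := if b then 1 else -1

/-- Sets whose trace on each level set of the labelling `c` is convex. -/
def IsConvexOnCells (c : ℝ → ℕ) (A : Set ℝ) : Prop :=
  ∀ u v w, u ≤ v → v ≤ w → c u = c w → u ∈ A → w ∈ A → v ∈ A

/-- One step of the recursion for the best gain of a player who is out, respectively in, after
the step `e` of the walk, when each entry costs `h`. -/
def gainStep (h : ℝ) (g : ℝ × ℝ) (e : ℝ) : ℝ × ℝ :=
  (max g.1 (g.2 + e), max (g.2 + e) (max g.1 (g.2 + e) - h))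

/-- The best gains of a player who is out, respectively in, at the end of the walk. -/
def bestGain (h : ℝ) : ∀ n : ℕ, (Fin n → Bool) → ℝ × ℝ
  | 0, _ => (0, -h)
  | n + 1, s => gainStep h (bestGain h n (Fin.init s)) (sgn (s (Fin.last n)))

/-- The potential that compensates the growth of the best gain. -/
def gainPotential (h : ℝ) (g : ℝ × ℝ) : ℝ := g.1 + (g.2 - g.1 + h) ^ 2 / (2 * h)

lemma bestGain_bounds {h : ℝ} (hh : 0 ≤ h) (n : ℕ) (s : Fin n → Bool) :
    (bestGain h n s).2 ≤ (bestGain h n s).1 ∧ (bestGain h n s).1 - h ≤ (bestGain h n s).2 := by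
  cases n with
  | zero => simp [bestGain, hh]
  | succ n =>
    simp only [bestGain, gainStep]
    refine ⟨max_le (le_max_right _ _) (by linarith), le_max_right _ _⟩

/-- The offset d = g.2 - g.1 + h is a walk confined to [0, h], and d² grows by 1 on average away
from the ends. At the lower end truncation only decreases d². At the upper end the overshoot y goes
into the first gain, and h² + 2hy ≤ (h + y)² pays for it. As h ≥ 2, both truncations cannot be
active for the same d, except trivially. -/
lemma gainPotential_step {h : ℝ} (hh : 2 ≤ h) (g : ℝ × ℝ) (h1 : g.2 ≤ g.1)
    (h2 : g.1 - h ≤ g.2) :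
    gainPotential h (gainStep h g 1) + gainPotential h (gainStep h g (-1))
      ≤ 2 * gainPotential h g + 1 / h := by
  obtain ⟨u, w⟩ := g
  simp only at h1 h2
  obtain ⟨d, rfl⟩ : ∃ d, w = d + u - h := ⟨w - u + h, by ring⟩
  have hpos : 0 < h := by linarith
  simp only [gainPotential, gainStep]
  have e1 : max u (d + u - h + -1) = u := max_eq_left (by linarith)
  rw [e1]
  -- Clears the denominator 2h; the 2 is the excess of (d + 1)² + (d - 1)² over 2d².
  have key : ∀ A B C : ℝ, 2 * h * A + B ≤ C + 2 → A + B / (2 * h) ≤ C / (2 * h) + 1 / h := by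
    intro A B C hABC
    have : A + B / (2 * h) = (2 * h * A + B) / (2 * h) := by field_simp
    rw [this]
    have : C / (2 * h) + 1 / h = (C + 2) / (2 * h) := by field_simp
    rw [this]
    gcongr
  rcases le_total (d + 1) h with hd | hd
  · have e2 : max u (d + u - h + 1) = u := max_eq_left (by linarith)
    rw [e2]
    have e3 : max (d + u - h + 1) (u - h) = d + u - h + 1 := max_eq_left (by linarith)
    rw [e3]
    rcases le_total 1 d with h3 | h3
    · rw [max_eq_left (by linarith : u - h ≤ d + u - h + -1)]
      have := key 0 ((d + 1) ^ 2 + (d - 1) ^ 2) (2 * d ^ 2) (by nlinarith)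
      ring_nf at this ⊢
      linarith
    · rw [max_eq_right (by linarith : d + u - h + -1 ≤ u - h)]
      have := key 0 ((d + 1) ^ 2) (2 * d ^ 2) (by nlinarith)
      ring_nf at this ⊢
      linarith
  · have e2 : max u (d + u - h + 1) = d + u - h + 1 := max_eq_right (by linarith)
    rw [e2]
    have e3 : max (d + u - h + 1) (d + u - h + 1 - h) = d + u - h + 1 :=
      max_eq_left (by linarith)
    rw [e3, max_eq_left (by linarith : u - h ≤ d + u - h + -1)]
    have := key (d + 1 - h) (h ^ 2 + (d - 1) ^ 2) (2 * d ^ 2) (by nlinarith)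
    ring_nf at this ⊢
    linarith

lemma sum_boolFun_succ (n : ℕ) (f : (Fin (n + 1) → Bool) → ℝ) :
    ∑ s, f s = ∑ s : Fin n → Bool, (f (Fin.snoc s true) + f (Fin.snoc s false)) := by
  rw [← (Fin.snocEquiv (fun _ : Fin (n + 1) => Bool)).sum_comp, Fintype.sum_prod_type_right]
  simp [Fin.snocEquiv]

/-- The potential starts at 0 and gains at most 1 / (2h) on average over each new sign. -/
lemma sum_gainPotential_le {h : ℝ} (hh : 2 ≤ h) (n : ℕ) :
    ∑ s, gainPotential h (bestGain h n s) ≤ 2 ^ n * (n / (2 * h)) := by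
  induction n with
  | zero => simp [bestGain, gainPotential]
  | succ n ih =>
    rw [sum_boolFun_succ]
    have hpos : 0 < h := by linarith
    calc _ ≤ ∑ s : Fin n → Bool, (2 * gainPotential h (bestGain h n s) + 1 / h) := by
          refine Finset.sum_le_sum fun s _ => ?_
          simp only [bestGain, Fin.init_snoc, Fin.snoc_last, sgn]
          exact gainPotential_step hh _ (bestGain_bounds hpos.le n s).1
            (bestGain_bounds hpos.le n s).2
      _ = 2 * ∑ s, gainPotential h (bestGain h n s) + 2 ^ n * (1 / h) := by
          rw [Finset.sum_add_distrib, ← Finset.mul_sum]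
          simp
      _ ≤ 2 * (2 ^ n * (n / (2 * h))) + 2 ^ n * (1 / h) := by gcongr
      _ = _ := by push_cast; field_simp; ring

lemma sum_bestGain_le {h : ℝ} (hh : 2 ≤ h) (n : ℕ) :
    ∑ s, (bestGain h n s).1 ≤ 2 ^ n * (n / (2 * h)) := by
  refine le_trans (Finset.sum_le_sum fun s _ => ?_) (sum_gainPotential_le hh n)
  have : 0 < h := by linarith
  simp only [gainPotential]
  have : 0 ≤ ((bestGain h n s).2 - (bestGain h n s).1 + h) ^ 2 / (2 * h) := by positivity
  linarith

/-- A set that is convex on the cells has a gain that is at most the best gain plus the cost of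
entering each cell once. -/
lemma exists_entries {h : ℝ} (hh : 0 ≤ h) {c : ℝ → ℕ} (hc : Monotone c) {A : Set ℝ}
    (hA : IsConvexOnCells c A) (n : ℕ) (y : Fin n → ℝ) (hy : Monotone y) (s : Fin n → Bool) :
    ∃ e : ℕ, (e = 0 ∨ ∃ i, y i ∈ A ∧ e ≤ c (y i) + 1) ∧
      ∑ i, sgn (s i) * A.indicator (fun _ => (1 : ℝ)) (y i) - h * e ≤ (bestGain h n s).1 ∧
      ∀ i : Fin n, i.val + 1 = n → y i ∈ A →
        ∑ i, sgn (s i) * A.indicator (fun _ => (1 : ℝ)) (y i) - h * e ≤ (bestGain h n s).2 := by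
  -- The last clause records whether the last point lies in `A`, so that an entry is charged only
  -- when a point of `A` is the first one or follows a point outside.
  induction n with
  | zero => exact ⟨0, Or.inl rfl, by simp [bestGain], fun i => i.elim0⟩
  | succ n ih =>
    obtain ⟨e, he, h1, h2⟩ := ih (Fin.init y)
      (fun i j hij => hy (by simpa using hij)) (Fin.init s)
    have hb := bestGain_bounds hh n (Fin.init s)
    simp only [Fin.sum_univ_castSucc, bestGain, gainStep]
    simp only [Fin.init] at h1 h2 he hb ⊢
    set S := ∑ i : Fin n, sgn (s i.castSucc) * A.indicator (fun _ => (1 : ℝ)) (y i.castSucc)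
    set G := bestGain h n fun i => s i.castSucc
    set σ := sgn (s (Fin.last n))
    by_cases hl : y (Fin.last n) ∈ A
    · rw [Set.indicator_of_mem hl, mul_one]
      by_cases hprev : ∃ i : Fin n, i.val + 1 = n ∧ y i.castSucc ∈ A
      · obtain ⟨i, hi, hiA⟩ := hprev
        have h3 := h2 i hi hiA
        refine ⟨e, ?_, ?_, fun _ _ _ => ?_⟩
        · rcases he with he | ⟨j, hj⟩
          · exact Or.inl he
          · exact Or.inr ⟨_, hj⟩
        · exact le_trans (by linarith) (le_max_right _ _)
        · exact le_trans (by linarith) (le_max_left _ _)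
      · refine ⟨e + 1, Or.inr ⟨Fin.last n, hl, ?_⟩, ?_, fun _ _ _ => ?_⟩
        · rcases he with rfl | ⟨j, hj, hej⟩
          · simp
          · have hn : 0 < n := j.pos
            let m : Fin n := ⟨n - 1, by omega⟩
            have hm : y m.castSucc ∉ A := fun hmA => hprev ⟨m, by simp [m]; omega, hmA⟩
            have hjm : y j.castSucc ≤ y m.castSucc := hy (by
              have := j.isLt
              change j.val ≤ n - 1
              omega)
            have hml : y m.castSucc ≤ y (Fin.last n) := hy (Fin.le_last _)
            -- The excluded point `y m` lies between two points of `A`, so these are in different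
            -- cells and the label has increased: the new entry is paid for.
            have hne : c (y j.castSucc) ≠ c (y (Fin.last n)) := fun heq =>
              hm (hA _ _ _ hjm hml heq hj hl)
            have := lt_of_le_of_ne (hc (hjm.trans hml)) hne
            omega
        · push_cast
          exact le_trans (by linarith) (le_max_right _ _)
        · push_cast
          exact le_trans (by linarith) (le_max_left _ _)
    · rw [Set.indicator_of_notMem hl, mul_zero, add_zero]
      refine ⟨e, ?_, le_trans h1 (le_max_left _ _), fun i hi hiA => ?_⟩
      · rcases he with he | ⟨j, hj⟩
        · exact Or.inl he
        · exact Or.inr ⟨_, hj⟩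
      · exact absurd ((show i = Fin.last n from Fin.ext (by simpa using hi)) ▸ hiA) hl

/-- Once the entries are refunded at total price at most `h * m`, the bound no longer depends on `A`
or `c`, so it survives the supremum over a family of sets. -/
lemma sum_sgn_indicator_le {h : ℝ} (hh : 0 ≤ h) {c : ℝ → ℕ} (hc : Monotone c) {m : ℕ}
    (hcm : ∀ y, c y < m) {A : Set ℝ} (hA : IsConvexOnCells c A) {n : ℕ} (x : Fin n → ℝ)
    (s : Fin n → Bool) :
    ∑ i, sgn (s i) * A.indicator (fun _ => (1 : ℝ)) (x i)
      ≤ h * m + (bestGain h n (s ∘ Tuple.sort x)).1 := by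
  obtain ⟨e, he, h1, -⟩ := exists_entries hh hc hA n (x ∘ Tuple.sort x) (Tuple.monotone_sort x)
    (s ∘ Tuple.sort x)
  have hem : (e : ℝ) ≤ m := by
    rcases he with rfl | ⟨i, -, hi⟩
    · simp
    · have := hcm ((x ∘ Tuple.sort x) i)
      exact_mod_cast (by omega : e ≤ m)
  rw [← Equiv.sum_comp (Tuple.sort x)]
  simp only [Function.comp] at h1 ⊢
  have := mul_le_mul_of_nonneg_left hem hh
  linarith

/-- The Rademacher average of a family of sets that are convex on `m` cells. -/
theorem sum_iSup_sgn_indicator_le {ι : Type*} [Nonempty ι] {c : ι → ℝ → ℕ}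
    (hc : ∀ j, Monotone (c j)) {m : ℕ} (hcm : ∀ j y, c j y < m) (A : ι → Set ℝ)
    (hA : ∀ j, IsConvexOnCells (c j) (A j)) {n : ℕ} (x : Fin n → ℝ) :
    ∑ s : Fin n → Bool, ⨆ j, ∑ i, sgn (s i) * (A j).indicator (fun _ => (1 : ℝ)) (x i)
      ≤ 2 ^ n * (2 * Real.sqrt (n * m)) := by
  have hm : 0 < m := (Nat.zero_le _).trans_lt (hcm (Classical.arbitrary ι) 0)
  -- For n ≤ 4m the trivial bound n is already at most 2√(nm); otherwise √(n/m) ≥ 2, as the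
  -- potential argument requires.
  rcases le_total (n : ℝ) (4 * m) with hnm | hnm
  · calc _ ≤ ∑ s : Fin n → Bool, (n : ℝ) := by
          refine Finset.sum_le_sum fun s _ => ciSup_le fun j => ?_
          refine (Finset.sum_le_card_nsmul _ _ 1 fun i _ => ?_).trans (by simp)
          unfold sgn Set.indicator
          split_ifs <;> norm_num
      _ = 2 ^ n * n := by simp
      _ ≤ _ := by
          gcongr
          rw [← Real.sqrt_sq (Nat.cast_nonneg n)]
          conv_rhs => rw [← Real.sqrt_sq (zero_le_two (α := ℝ)), ← Real.sqrt_mul (by norm_num)]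
          apply Real.sqrt_le_sqrt
          have : (0 : ℝ) ≤ n := Nat.cast_nonneg n
          nlinarith [Real.sqrt_sq this]
  · have hm' : (0 : ℝ) < m := by exact_mod_cast hm
    have hn' : (0 : ℝ) < n := by linarith
    set h : ℝ := Real.sqrt (n / m) with hdef
    have hh : 2 ≤ h := Real.le_sqrt_of_sq_le (by rw [le_div_iff₀ hm']; linarith)
    have e1 : h * m = Real.sqrt (n * m) := by
      rw [hdef, Real.sqrt_div hn'.le, Real.sqrt_mul hn'.le]
      nth_rewrite 2 [← Real.mul_self_sqrt hm'.le]
      field_simp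
    have e2 : (n : ℝ) / (2 * h) = Real.sqrt (n * m) / 2 := by
      rw [← e1]
      have : h * h = n / m := Real.mul_self_sqrt (by positivity)
      have hpos : 0 < h := by linarith
      field_simp
      rw [pow_two, this]; field_simp
    calc _ ≤ ∑ s : Fin n → Bool, (h * m + (bestGain h n (s ∘ Tuple.sort x)).1) := by
          refine Finset.sum_le_sum fun s _ => ciSup_le fun j => ?_
          exact sum_sgn_indicator_le (by linarith) (hc j) (hcm j) (hA j) x s
      _ = 2 ^ n * (h * m) + ∑ s : Fin n → Bool, (bestGain h n s).1 := by
          rw [Finset.sum_add_distrib]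
          congr 1
          · simp
          -- Permuting the signs by the sorting permutation is a bijection, so the ordering of the
          -- sample disappears on summation.
          · exact ((Tuple.sort x).arrowCongr (Equiv.refl Bool)).symm.sum_comp
              (fun s => (bestGain h n s).1)
      _ ≤ 2 ^ n * (h * m) + 2 ^ n * (n / (2 * h)) := by
          gcongr
          exact sum_bestGain_le hh n
      _ ≤ _ := by
          rw [e1, e2, ← mul_add]
          gcongr
          linarith [Real.sqrt_nonneg (n * m : ℝ)]

/-! ### Symmetrization -/

/-- Exchange of the coordinates of `z` where `s` is false. -/
def signedSwap {n : ℕ} (s : Fin n → Bool) (z : (Fin n → ℝ) × (Fin n → ℝ)) :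
    (Fin n → ℝ) × (Fin n → ℝ) :=
  (fun i => if s i then z.1 i else z.2 i, fun i => if s i then z.2 i else z.1 i)

lemma measurePreserving_signedSwap {n : ℕ} (μ : Fin n → Measure ℝ)
    [∀ i, IsProbabilityMeasure (μ i)] (s : Fin n → Bool) :
    MeasurePreserving (signedSwap s) ((Measure.pi μ).prod (Measure.pi μ))
      ((Measure.pi μ).prod (Measure.pi μ)) := by
  have h1 := measurePreserving_arrowProdEquivProdArrow ℝ ℝ (Fin n) μ μ
  have h2 : MeasurePreserving
      (fun (z : Fin n → ℝ × ℝ) i => (if s i then id else Prod.swap : ℝ × ℝ → ℝ × ℝ) (z i))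
      (Measure.pi fun i => (μ i).prod (μ i)) (Measure.pi fun i => (μ i).prod (μ i)) := by
    refine measurePreserving_pi _ _ fun i => ?_
    split_ifs
    · exact MeasurePreserving.id _
    · exact Measure.measurePreserving_swap
  have h3 := (h1.comp h2).comp (h1.symm _)
  convert h3 using 1
  ext z i
  · simp only [signedSwap, Function.comp, MeasurableEquiv.arrowProdEquivProdArrow,
      Equiv.arrowProdEquivProdArrow, MeasurableEquiv.coe_mk, MeasurableEquiv.symm_mk,
      Equiv.coe_fn_mk, Equiv.coe_fn_symm_mk]
    split_ifs <;> rfl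
  · simp only [signedSwap, Function.comp, MeasurableEquiv.arrowProdEquivProdArrow,
      Equiv.arrowProdEquivProdArrow, MeasurableEquiv.coe_mk, MeasurableEquiv.symm_mk,
      Equiv.coe_fn_mk, Equiv.coe_fn_symm_mk]
    split_ifs <;> rfl

lemma abs_sum_sub_le {n : ℕ} (a b : Fin n → ℝ) (ha : ∀ i, a i ∈ Set.Icc (0 : ℝ) 1)
    (hb : ∀ i, b i ∈ Set.Icc (0 : ℝ) 1) : |∑ i, (a i - b i)| ≤ n := by
  refine (Finset.abs_sum_le_sum_abs _ _).trans
    ((Finset.sum_le_card_nsmul _ _ 1 fun i _ => ?_).trans (by simp))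
  rw [abs_le]
  constructor <;> linarith [(ha i).1, (ha i).2, (hb i).1, (hb i).2]

lemma indicator_one_mem_Icc (A : Set ℝ) (y : ℝ) :
    A.indicator (fun _ => (1 : ℝ)) y ∈ Set.Icc (0 : ℝ) 1 := by
  unfold Set.indicator
  split_ifs <;> simp

lemma abs_ciSup_le {ι : Type*} [Nonempty ι] {f : ι → ℝ} {C : ℝ} (hf : ∀ j, |f j| ≤ C) :
    |⨆ j, f j| ≤ C := by
  have hb : BddAbove (Set.range f) :=
    ⟨C, by rintro _ ⟨j, rfl⟩; exact (le_abs_self _).trans (hf j)⟩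
  obtain ⟨j⟩ := ‹Nonempty ι›
  rw [abs_le]
  exact ⟨(abs_le.1 (hf j)).1.trans (le_ciSup hb j),
    ciSup_le fun j => (le_abs_self _).trans (hf j)⟩

lemma bddAbove_range_of_abs_le {ι : Type*} {f : ι → ℝ} {C : ℝ} (hf : ∀ j, |f j| ≤ C) :
    BddAbove (Set.range f) :=
  ⟨C, by rintro _ ⟨j, rfl⟩; exact (le_abs_self _).trans (hf j)⟩

lemma integrable_of_abs_le {α : Type*} [MeasurableSpace α] {μ : Measure α} [IsFiniteMeasure μ]
    {f : α → ℝ} (hf : Measurable f) {C : ℝ} (hC : ∀ x, |f x| ≤ C) : Integrable f μ :=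
  Integrable.of_bound hf.aestronglyMeasurable C (Filter.Eventually.of_forall fun x => by
    simpa [Real.norm_eq_abs] using hC x)

section Empirical

variable {n : ℕ} {ι : Type*} {A : ι → Set ℝ}

lemma measurable_indicator_coord (hA : ∀ j, MeasurableSet (A j)) (j : ι) (i : Fin n) :
    Measurable fun x : Fin n → ℝ => (A j).indicator (fun _ => (1 : ℝ)) (x i) :=
  (measurable_const.indicator (hA j)).comp (measurable_pi_apply i)

lemma measurable_iSup_empirical [Countable ι] (hA : ∀ j, MeasurableSet (A j)) (c : Fin n → ι → ℝ) :
    Measurable fun x : Fin n → ℝ =>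
      ⨆ j, ∑ i, ((A j).indicator (fun _ => (1 : ℝ)) (x i) - c i j) :=
  Measurable.iSup fun j => Finset.measurable_sum _ fun i _ =>
    (measurable_indicator_coord hA j i).sub_const _

lemma integral_indicator_coord (μ : Fin n → Measure ℝ) [∀ i, IsProbabilityMeasure (μ i)]
    (hA : ∀ j, MeasurableSet (A j)) (j : ι) (i : Fin n) :
    ∫ x, (A j).indicator (fun _ => (1 : ℝ)) (x i) ∂Measure.pi μ = (μ i).real (A j) := by
  have := (measurePreserving_eval μ i).map_eq
  rw [← integral_indicator_one (hA j), ← this, integral_map (measurable_pi_apply i).aemeasurable]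
  · rfl
  · exact (measurable_const.indicator (hA j)).aestronglyMeasurable

/-- Symmetrization: the expected supremum of the centred empirical process is at most twice
a uniform bound for the Rademacher averages. -/
theorem integral_iSup_empirical_le [Countable ι] [Nonempty ι] (μ : Fin n → Measure ℝ)
    [∀ i, IsProbabilityMeasure (μ i)]
    (hA : ∀ j, MeasurableSet (A j)) {C : ℝ}
    (hC : ∀ x : Fin n → ℝ, ∑ s : Fin n → Bool,
      ⨆ j, ∑ i, sgn (s i) * (A j).indicator (fun _ => (1 : ℝ)) (x i) ≤ 2 ^ n * C) :
    ∫ x, ⨆ j, ∑ i, ((A j).indicator (fun _ => (1 : ℝ)) (x i) - (μ i).real (A j)) ∂Measure.pi μ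
      ≤ 2 * C := by
  set π := Measure.pi μ
  let g : ι → Fin n → (Fin n → ℝ) → ℝ := fun j i x => (A j).indicator (fun _ => (1 : ℝ)) (x i)
  have hg : ∀ j i, Measurable (g j i) := measurable_indicator_coord hA
  have hg01 : ∀ j i x, g j i x ∈ Set.Icc (0 : ℝ) 1 := fun j i x => indicator_one_mem_Icc _ _
  let F : (Fin n → ℝ) × (Fin n → ℝ) → ℝ := fun z => ⨆ j, ∑ i, (g j i z.1 - g j i z.2)
  have hFm : Measurable F := Measurable.iSup fun j => Finset.measurable_sum _ fun i _ =>
    ((hg j i).comp measurable_fst).sub ((hg j i).comp measurable_snd)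
  have hFj : ∀ (z : (Fin n → ℝ) × (Fin n → ℝ)) j, |∑ i, (g j i z.1 - g j i z.2)| ≤ n := fun z j =>
    abs_sum_sub_le _ _ (fun i => hg01 j i z.1) (fun i => hg01 j i z.2)
  have hFb : ∀ z, |F z| ≤ n := fun z => abs_ciSup_le (hFj z)
  have hFi : Integrable F (π.prod π) := integrable_of_abs_le hFm hFb
  have hgi : ∀ j i, Integrable (g j i) π := fun j i =>
    integrable_of_abs_le (C := 1) (hg j i) fun x => abs_le.2
      ⟨by linarith [(hg01 j i x).1], (hg01 j i x).2⟩
  have hsub : ∀ j x i, Integrable (fun y => g j i x - g j i y) π := fun j x i =>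
    (integrable_const _).sub (hgi j i)
  -- The means are replaced by a ghost sample: a supremum of integrals is at most the integral of
  -- the supremum.
  have step1 : ∫ x, ⨆ j, ∑ i, (g j i x - (μ i).real (A j)) ∂π ≤ ∫ z, F z ∂(π.prod π) := by
    rw [integral_prod _ hFi]
    refine integral_mono ?_ hFi.integral_prod_left fun x => ciSup_le fun j => ?_
    · refine integrable_of_abs_le (C := n) (measurable_iSup_empirical hA _) fun x =>
        abs_ciSup_le fun j => abs_sum_sub_le _ _ (fun i => hg01 j i x) fun i =>
          ⟨measureReal_nonneg, measureReal_le_one⟩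
    · calc ∑ i, (g j i x - (μ i).real (A j)) = ∫ y, ∑ i, (g j i x - g j i y) ∂π := by
            rw [integral_finsetSum _ fun i _ => hsub j x i]
            refine Finset.sum_congr rfl fun i _ => ?_
            rw [integral_sub (integrable_const _) (hgi j i), integral_const,
              integral_indicator_coord μ hA]
            simp
        _ ≤ ∫ y, F (x, y) ∂π := by
            refine integral_mono (integrable_finsetSum _ fun i _ => hsub j x i) ?_ fun y => ?_
            · exact integrable_of_abs_le (hFm.comp measurable_prodMk_left) fun y => hFb _
            · exact le_ciSup (bddAbove_range_of_abs_le (hFj (x, y))) j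
  let R : (Fin n → Bool) → (Fin n → ℝ) → ℝ := fun s x => ⨆ j, ∑ i, sgn (s i) * g j i x
  have hRj : ∀ (s : Fin n → Bool) x j, |∑ i, sgn (s i) * g j i x| ≤ n := fun s x j => by
    refine (Finset.abs_sum_le_sum_abs _ _).trans
      ((Finset.sum_le_card_nsmul _ _ 1 fun i _ => ?_).trans (by simp))
    have := hg01 j i x
    rw [abs_mul, abs_of_nonneg this.1]
    have h1 : |sgn (s i)| = 1 := by unfold sgn; split_ifs <;> simp
    rw [h1, one_mul]
    exact this.2
  -- The ghost sample carries the opposite signs; flipping all signs permutes the sign vectors, so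
  -- both halves have the same bound.
  let nt : (Fin n → Bool) ≃ (Fin n → Bool) := (Equiv.refl _).arrowCongr Equiv.boolNot
  have hswap : ∀ s z, F (signedSwap s z) ≤ R s z.1 + R (nt s) z.2 := by
    intro s z
    refine ciSup_le fun j => ?_
    have e : ∑ i, (g j i (signedSwap s z).1 - g j i (signedSwap s z).2)
        = ∑ i, sgn (s i) * g j i z.1 + ∑ i, sgn (nt s i) * g j i z.2 := by
      rw [← Finset.sum_add_distrib]
      refine Finset.sum_congr rfl fun i _ => ?_
      simp only [g, signedSwap, nt, sgn, Equiv.arrowCongr_apply, Function.comp, Equiv.refl_symm,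
        Equiv.refl_apply, Equiv.boolNot_apply]
      cases s i <;> simp <;> ring
    rw [e]
    exact add_le_add (le_ciSup (bddAbove_range_of_abs_le (hRj s z.1)) j)
      (le_ciSup (bddAbove_range_of_abs_le (hRj (nt s) z.2)) j)
  have step2 : 2 ^ n * ∫ z, F z ∂(π.prod π) ≤ 2 ^ n * (2 * C) := by
    have hmp := measurePreserving_signedSwap μ
    have e : ∀ s, ∫ z, F (signedSwap s z) ∂(π.prod π) = ∫ z, F z ∂(π.prod π) := fun s => by
      conv_rhs => rw [← (hmp s).map_eq]
      rw [integral_map (hmp s).measurable.aemeasurable hFm.aestronglyMeasurable]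
    have hi : ∀ s, Integrable (fun z => F (signedSwap s z)) (π.prod π) := fun s =>
      integrable_of_abs_le (hFm.comp (hmp s).measurable) fun z => hFb _
    calc 2 ^ n * ∫ z, F z ∂(π.prod π)
        = ∑ s : Fin n → Bool, ∫ z, F (signedSwap s z) ∂(π.prod π) := by simp [e]
      _ = ∫ z, ∑ s : Fin n → Bool, F (signedSwap s z) ∂(π.prod π) :=
          (integral_finsetSum _ fun s _ => hi s).symm
      _ ≤ ∫ z, 2 ^ n * (2 * C) ∂(π.prod π) := by
          refine integral_mono (integrable_finsetSum _ fun s _ => hi s) (integrable_const _)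
            fun z => ?_
          calc ∑ s : Fin n → Bool, F (signedSwap s z)
              ≤ ∑ s, (R s z.1 + R (nt s) z.2) := Finset.sum_le_sum fun s _ => hswap s z
            _ = ∑ s, R s z.1 + ∑ s, R s z.2 := by
                rw [Finset.sum_add_distrib, nt.sum_comp (fun s => R s z.2)]
            _ ≤ 2 ^ n * C + 2 ^ n * C := add_le_add (hC _) (hC _)
            _ = 2 ^ n * (2 * C) := by ring
      _ = 2 ^ n * (2 * C) := by simp
  exact step1.trans (le_of_mul_le_mul_left step2 (by positivity))

/-- The expected supremum of the centred empirical process over a countable family of sets that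
are convex on `m` cells. -/
theorem integral_iSup_empirical_le_sqrt [Countable ι] [Nonempty ι] (μ : Fin n → Measure ℝ)
    [∀ i, IsProbabilityMeasure (μ i)] (hA : ∀ j, MeasurableSet (A j)) {c : ι → ℝ → ℕ}
    (hc : ∀ j, Monotone (c j)) {m : ℕ} (hcm : ∀ j y, c j y < m)
    (hAc : ∀ j, IsConvexOnCells (c j) (A j)) :
    ∫ x, ⨆ j, ∑ i, ((A j).indicator (fun _ => (1 : ℝ)) (x i) - (μ i).real (A j)) ∂Measure.pi μ
      ≤ 4 * Real.sqrt (n * m) := by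
  refine (integral_iSup_empirical_le μ hA fun x =>
    sum_iSup_sgn_indicator_le hc hcm A hAc x).trans_eq (by ring)

end Empirical

/-! ### Cells cut by a finite set -/

/-- The label of the cell of `y`, the cells being the points of `B` and the intervals between
them. -/
def cellLabel (B : Finset ℝ) (y : ℝ) : ℕ := (B.filter (· < y)).card + (B.filter (· ≤ y)).card

lemma filter_lt_subset (B : Finset ℝ) {u v : ℝ} (h : u ≤ v) :
    B.filter (· < u) ⊆ B.filter (· < v) :=
  Finset.monotone_filter_right _ fun _ _ hb => lt_of_lt_of_le hb h

lemma filter_le_subset (B : Finset ℝ) {u v : ℝ} (h : u ≤ v) :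
    B.filter (· ≤ u) ⊆ B.filter (· ≤ v) :=
  Finset.monotone_filter_right _ fun _ _ hb => le_trans hb h

lemma cellLabel_mono (B : Finset ℝ) : Monotone (cellLabel B) := fun _ _ h =>
  add_le_add (Finset.card_le_card (filter_lt_subset B h))
    (Finset.card_le_card (filter_le_subset B h))

lemma cellLabel_lt (B : Finset ℝ) (y : ℝ) : cellLabel B y < 2 * B.card + 1 := by
  have h1 := Finset.card_filter_le B (· < y)
  have h2 := Finset.card_filter_le B (· ≤ y)
  unfold cellLabel
  omega

/-- Both counts in the label are monotone, so equal labels make both filters equal. A point of `B`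
in [u, v] would enlarge the strict one if it is below v, and the other one if it equals v. -/
lemma notMem_Icc_of_cellLabel_eq {B : Finset ℝ} {u v : ℝ} (h : u < v)
    (he : cellLabel B u = cellLabel B v) : ∀ b ∈ B, b ∉ Set.Icc u v := by
  intro b hb hbI
  have h1 := filter_lt_subset B h.le
  have h2 := filter_le_subset B h.le
  have c1 := Finset.card_le_card h1
  have c2 := Finset.card_le_card h2
  unfold cellLabel at he
  have e1 := Finset.eq_of_subset_of_card_le h1 (by omega)
  have e2 := Finset.eq_of_subset_of_card_le h2 (by omega)
  rcases hbI.2.lt_or_eq with hlt | rfl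
  · have : b ∈ B.filter (· < v) := by simp [hb, hlt]
    rw [← e1] at this
    exact absurd (Finset.mem_filter.1 this).2 (not_lt.2 hbI.1)
  · have : b ∈ B.filter (· ≤ b) := by simp [hb]
    rw [← e2] at this
    exact absurd (Finset.mem_filter.1 this).2 (not_le.2 h)

lemma exists_mem_openPieces {A : Finset ℝ} (hA : A.Nonempty) {u v : ℝ} (huv : u ≤ v)
    (h : ∀ b ∈ A, b ∉ Set.Icc u v) : ∃ I ∈ openPieces A, u ∈ I ∧ v ∈ I := by
  by_cases hl : (A.filter (· < u)).Nonempty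
  · have hlm := Finset.mem_filter.1 ((A.filter (· < u)).max'_mem hl)
    by_cases hr : (A.filter (v < ·)).Nonempty
    · have hrm := Finset.mem_filter.1 ((A.filter (v < ·)).min'_mem hr)
      refine ⟨_, Or.inr (Or.inl ⟨_, hlm.1, _, hrm.1, ?_, fun c hc hcI => ?_, rfl⟩),
        ⟨hlm.2, huv.trans_lt hrm.2⟩, ⟨hlm.2.trans_le huv, hrm.2⟩⟩
      · exact hlm.2.trans_le (huv.trans hrm.2.le)
      · rcases lt_or_ge c u with hcu | hcu
        · exact absurd ((A.filter (· < u)).le_max' c (by simp [hc, hcu])) (not_le.2 hcI.1)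
        · rcases lt_or_ge v c with hcv | hcv
          · exact absurd ((A.filter (v < ·)).min'_le c (by simp [hc, hcv])) (not_le.2 hcI.2)
          · exact h c hc ⟨hcu, hcv⟩
    · have hlt : A.max' hA < u := by
        by_contra hcon
        have hmem := A.max'_mem hA
        refine hr ⟨A.max' hA, Finset.mem_filter.2 ⟨hmem, ?_⟩⟩
        by_contra hv
        exact h _ hmem ⟨not_lt.1 hcon, not_lt.1 hv⟩
      exact ⟨_, Or.inr (Or.inr ⟨_, A.max'_mem hA, fun b hb => A.le_max' b hb, rfl⟩), hlt,
        hlt.trans_le huv⟩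
  · have hlt : v < A.min' hA := by
      by_contra hcon
      have hmem := A.min'_mem hA
      refine hl ⟨A.min' hA, Finset.mem_filter.2 ⟨hmem, ?_⟩⟩
      by_contra hv
      exact h _ hmem ⟨not_lt.1 hv, not_lt.1 hcon⟩
    exact ⟨_, Or.inl ⟨_, A.min'_mem hA, fun b hb => A.min'_le b hb, rfl⟩, huv.trans_lt hlt, hlt⟩

lemma ordConnected_of_mem_openPieces {A : Finset ℝ} {I : Set ℝ} (hI : I ∈ openPieces A) :
    I.OrdConnected := by
  rcases hI with ⟨a, -, -, rfl⟩ | ⟨a, -, b, -, -, -, rfl⟩ | ⟨a, -, -, rfl⟩ <;> infer_instance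

lemma notMem_of_mem_openPieces {A : Finset ℝ} {I : Set ℝ} (hI : I ∈ openPieces A) {b : ℝ}
    (hb : b ∈ A) : b ∉ I := by
  rcases hI with ⟨a, -, h, rfl⟩ | ⟨a, -, c, -, -, h, rfl⟩ | ⟨a, -, h, rfl⟩
  · exact not_lt.2 (h b hb)
  · exact h b hb
  · exact not_lt.2 (h b hb)

/-- Between two distinct points of one cell there is no cut point, so `p` is constant and `q` is
monotone there, and superlevel sets of a monotone function are convex. -/
lemma isConvexOnCells_lt_and_le {p q : ℝ → ℝ} {A B : Finset ℝ} (hA : A.Nonempty)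
    (hB : B.Nonempty) (hq : ∀ I ∈ openPieces A, IsMonotoneOn q I)
    (hp : ∀ I ∈ openPieces B, ∃ c : ℝ, ∀ x ∈ I, p x = c) :
    IsConvexOnCells (cellLabel (A ∪ B)) {y | p y < q y} ∧
      IsConvexOnCells (cellLabel (A ∪ B)) {y | p y ≤ q y} := by
  have key : ∀ u v w, u ≤ v → v ≤ w → cellLabel (A ∪ B) u = cellLabel (A ∪ B) w →
      v = u ∨ (p u = p v ∧ p w = p v ∧ (q u ≤ q v ∨ q w ≤ q v)) := by
    intro u v w huv hvw he
    rcases (huv.trans hvw).eq_or_lt with rfl | huw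
    · exact Or.inl (le_antisymm hvw huv)
    · have hn := notMem_Icc_of_cellLabel_eq huw he
      obtain ⟨I, hI, hu, hw⟩ := exists_mem_openPieces hA huw.le fun b hb =>
        hn b (Finset.mem_union_left _ hb)
      obtain ⟨J, hJ, hu', hw'⟩ := exists_mem_openPieces hB huw.le fun b hb =>
        hn b (Finset.mem_union_right _ hb)
      have hv : v ∈ I := (ordConnected_of_mem_openPieces hI).out hu hw ⟨huv, hvw⟩
      have hv' : v ∈ J := (ordConnected_of_mem_openPieces hJ).out hu' hw' ⟨huv, hvw⟩
      obtain ⟨c, hc⟩ := hp J hJ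
      refine Or.inr ⟨by rw [hc u hu', hc v hv'], by rw [hc w hw', hc v hv'], ?_⟩
      rcases hq I hI with hm | hm
      · exact Or.inl (hm hu hv huv)
      · exact Or.inr (hm hv hw hvw)
  constructor
  · intro u v w huv hvw he hu hw
    simp only [Set.mem_ofPred_eq] at hu hw ⊢
    rcases key u v w huv hvw he with rfl | ⟨h1, h2, h3 | h3⟩
    · exact hu
    · linarith
    · linarith
  · intro u v w huv hvw he hu hw
    simp only [Set.mem_ofPred_eq] at hu hw ⊢
    rcases key u v w huv hvw he with rfl | ⟨h1, h2, h3 | h3⟩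
    · exact hu
    · linarith
    · linarith

/-! ### Total variation distance -/

lemma real_sub_real_le_one (P Q : Measure ℝ) [IsProbabilityMeasure P] (A : Set ℝ) :
    P.real A - Q.real A ≤ 1 := by
  linarith [measureReal_le_one (μ := P) (s := A), measureReal_nonneg (μ := Q) (s := A)]

lemma tvDist_le (P Q : Measure ℝ) {C : ℝ} (h : ∀ A, MeasurableSet A → P.real A - Q.real A ≤ C) :
    tvDist P Q ≤ C :=
  have : Nonempty {A : Set ℝ // MeasurableSet A} := ⟨⟨∅, MeasurableSet.empty⟩⟩
  ciSup_le fun A => h A.1 A.2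

lemma real_sub_le_tvDist (P Q : Measure ℝ) [IsProbabilityMeasure P] {A : Set ℝ}
    (hA : MeasurableSet A) :
    P.real A - Q.real A ≤ tvDist P Q :=
  le_ciSup (f := fun A : {A : Set ℝ // MeasurableSet A} => P.real A.1 - Q.real A.1)
    ⟨1, by rintro _ ⟨B, rfl⟩; exact real_sub_real_le_one P Q B.1⟩ ⟨A, hA⟩

lemma tvDist_le_one (P Q : Measure ℝ) [IsProbabilityMeasure P] : tvDist P Q ≤ 1 :=
  tvDist_le P Q fun A _ => real_sub_real_le_one P Q A

lemma tvDist_nonneg (P Q : Measure ℝ) [IsProbabilityMeasure P] : 0 ≤ tvDist P Q := by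
  simpa using real_sub_le_tvDist P Q MeasurableSet.empty

lemma tvDist_triangle (P Q R : Measure ℝ) [IsProbabilityMeasure P] [IsProbabilityMeasure Q] :
    tvDist P R ≤ tvDist P Q + tvDist Q R :=
  tvDist_le P R fun A hA => by
    linarith [real_sub_le_tvDist P Q hA, real_sub_le_tvDist Q R hA]

lemma tvDist_comm_le (P Q : Measure ℝ) [IsProbabilityMeasure P] [IsProbabilityMeasure Q] :
    tvDist P Q ≤ tvDist Q P :=
  tvDist_le P Q fun A hA => by
    have := real_sub_le_tvDist Q P hA.compl
    rw [probReal_compl_eq_one_sub hA, probReal_compl_eq_one_sub hA] at this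
    linarith

lemma tvDist_comm (P Q : Measure ℝ) [IsProbabilityMeasure P] [IsProbabilityMeasure Q] :
    tvDist P Q = tvDist Q P :=
  le_antisymm (tvDist_comm_le P Q) (tvDist_comm_le Q P)

/-! ### Densities -/

section Density

variable {p q : ℝ → ℝ}

lemma IsDensity.integrable (hp : IsDensity p) : Integrable p := by
  refine ⟨hp.measurable.aestronglyMeasurable, ?_⟩
  rw [hasFiniteIntegral_iff_ofReal (Filter.Eventually.of_forall hp.nonneg),
    hp.lintegral_eq_one]
  exact ENNReal.one_lt_top

lemma IsDensity.integral_eq_one (hp : IsDensity p) : ∫ x, p x = 1 := by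
  rw [integral_eq_lintegral_of_nonneg_ae (Filter.Eventually.of_forall hp.nonneg)
    hp.measurable.aestronglyMeasurable, hp.lintegral_eq_one, ENNReal.toReal_one]

lemma isDensity_of_integral_eq_one (hm : Measurable p) (h0 : ∀ x, 0 ≤ p x) (hi : Integrable p)
    (h1 : ∫ x, p x = 1) : IsDensity p := by
  refine ⟨hm, h0, ?_⟩
  rw [← ofReal_integral_eq_lintegral_ofReal hi (Filter.Eventually.of_forall h0), h1,
    ENNReal.ofReal_one]

lemma IsDensity.isProbabilityMeasure (hp : IsDensity p) :
    IsProbabilityMeasure (densityMeasure p) :=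
  ⟨by rw [densityMeasure, withDensity_apply _ MeasurableSet.univ, Measure.restrict_univ,
    hp.lintegral_eq_one]⟩

lemma IsDensity.real_eq (hp : IsDensity p) {A : Set ℝ} (hA : MeasurableSet A) :
    (densityMeasure p).real A = ∫ x in A, p x := by
  rw [integral_eq_lintegral_of_nonneg_ae (Filter.Eventually.of_forall hp.nonneg)
    hp.measurable.aestronglyMeasurable, Measure.real, densityMeasure, withDensity_apply _ hA]

lemma IsDensity.real_sub_real (hp : IsDensity p) (hq : IsDensity q) {A : Set ℝ}
    (hA : MeasurableSet A) :
    (densityMeasure p).real A - (densityMeasure q).real A = ∫ x in A, (p x - q x) := by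
  rw [hp.real_eq hA, hq.real_eq hA,
    integral_sub hp.integrable.integrableOn hq.integrable.integrableOn]

lemma IsDensity.real_sub_real_setOf_lt (hp : IsDensity p) (hq : IsDensity q) :
    (densityMeasure p).real {x | q x < p x} - (densityMeasure q).real {x | q x < p x}
      = ∫ x, max (p x - q x) 0 := by
  have hm : MeasurableSet {x | q x < p x} := measurableSet_lt hq.measurable hp.measurable
  rw [hp.real_sub_real hq hm, ← integral_indicator hm]
  congr 1
  ext x
  by_cases h : q x < p x
  · rw [Set.indicator_of_mem (show x ∈ {x | q x < p x} from h), max_eq_left (by linarith)]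
  · rw [Set.indicator_of_notMem (show x ∉ {x | q x < p x} from h), max_eq_right (by linarith)]

/-- The supremum is attained on the set {q < p}. -/
lemma IsDensity.tvDist_eq (hp : IsDensity p) (hq : IsDensity q) :
    tvDist (densityMeasure p) (densityMeasure q) = ∫ x, max (p x - q x) 0 := by
  have := hp.isProbabilityMeasure
  have := hq.isProbabilityMeasure
  have hi : Integrable fun x => p x - q x := hp.integrable.sub hq.integrable
  refine le_antisymm (tvDist_le _ _ fun A hA => ?_) ?_
  · rw [hp.real_sub_real hq hA]
    calc ∫ x in A, (p x - q x) ≤ ∫ x in A, max (p x - q x) 0 :=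
          integral_mono hi.integrableOn hi.pos_part.integrableOn fun x => le_max_left _ _
      _ ≤ ∫ x, max (p x - q x) 0 :=
          setIntegral_le_integral hi.pos_part (Filter.Eventually.of_forall fun x =>
            le_max_right _ _)
  · rw [← hp.real_sub_real_setOf_lt hq]
    exact real_sub_le_tvDist _ _ (measurableSet_lt hq.measurable hp.measurable)

lemma IsDensity.l1Dist_eq (hp : IsDensity p) (hq : IsDensity q) :
    l1Dist p q = 2 * tvDist (densityMeasure p) (densityMeasure q) := by
  have hi : Integrable fun x => p x - q x := hp.integrable.sub hq.integrable
  rw [hp.tvDist_eq hq, l1Dist]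
  have e : ∀ x, |p x - q x| = 2 * max (p x - q x) 0 - (p x - q x) := fun x => by
    rcases le_total (p x - q x) 0 with h | h
    · rw [abs_of_nonpos h, max_eq_right h]; ring
    · rw [abs_of_nonneg h, max_eq_left h]; ring
  simp_rw [e]
  rw [integral_sub (hi.pos_part.const_mul 2) hi, integral_const_mul,
    integral_sub hp.integrable hq.integrable, hp.integral_eq_one, hq.integral_eq_one]
  ring

end Density

/-- The distance to a random probability measure with values in a countable family of densities
is measurable. -/
lemma measurable_tvDist (P : Measure ℝ) [IsProbabilityMeasure P] {M : Set (ℝ → ℝ)}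
    (hM : M.Countable) (hMd : ∀ q ∈ M, IsDensity q) {Ω : Type*} [MeasurableSpace Ω]
    {f : Ω → ℝ → ℝ} (hf : Measurable fun ω => densityMeasure (f ω)) (hfM : ∀ ω, f ω ∈ M) :
    Measurable fun ω => tvDist P (densityMeasure (f ω)) := by
  rcases isEmpty_or_nonempty Ω with hΩ | ⟨⟨ω₀⟩⟩
  · exact measurable_of_empty _
  have : Countable M := hM.to_subtype
  have : Nonempty (M × ℕ) := ⟨(⟨f ω₀, hfM ω₀⟩, 0)⟩
  -- Since `M` is countable, countably many near-optimal sets suffice to compute the distance to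
  -- every element of `M`.
  have hA : ∀ s : M × ℕ, ∃ A, MeasurableSet A ∧
      tvDist P (densityMeasure s.1.1) - 1 / ((s.2 : ℝ) + 1)
        ≤ P.real A - (densityMeasure s.1.1).real A := by
    rintro ⟨⟨q, hq⟩, l⟩
    by_contra! hcon
    have := (hMd q hq).isProbabilityMeasure
    have := tvDist_le P (densityMeasure q) fun A hA => (hcon A hA).le
    have h0 : (0 : ℝ) < 1 / ((l : ℝ) + 1) := by positivity
    simp only at this
    linarith
  choose A hAm hA using hA
  have hbd : ∀ ω, BddAbove (Set.range fun s => P.real (A s) - (densityMeasure (f ω)).real (A s)) :=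
    fun ω => ⟨1, by
      rintro _ ⟨s, rfl⟩
      have := (hMd _ (hfM ω)).isProbabilityMeasure
      exact real_sub_real_le_one _ _ _⟩
  have e : (fun ω => tvDist P (densityMeasure (f ω)))
      = fun ω => ⨆ s, (P.real (A s) - (densityMeasure (f ω)).real (A s)) := by
    ext ω
    have := (hMd _ (hfM ω)).isProbabilityMeasure
    refine le_antisymm ?_ (ciSup_le fun s => real_sub_le_tvDist _ _ (hAm s))
    refine le_of_forall_pos_le_add fun δ hδ => ?_
    obtain ⟨l, hl⟩ := exists_nat_one_div_lt hδ
    have h1 := hA (⟨f ω, hfM ω⟩, l)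
    have h2 := le_ciSup (hbd ω) (⟨f ω, hfM ω⟩, l)
    simp only at h1 h2
    linarith
  rw [e]
  exact Measurable.iSup fun s =>
    measurable_const.sub (((Measure.measurable_coe (hAm s)).comp hf).ennreal_toReal)

/-! ### The deterministic inequality for TV-estimators -/

section Oracle

variable {n k : ℕ} {M : Set (ℝ → ℝ)} {ε : ℝ} {phat : (Fin n → ℝ) → ℝ → ℝ}

lemma abs_testStat_le {p q : ℝ → ℝ} (hp : IsDensity p) (x : Fin n → ℝ) :
    |testStat x p q| ≤ n := by
  have := hp.isProbabilityMeasure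
  exact abs_sum_sub_le _ _ (fun i => indicator_one_mem_Icc _ _)
    fun i => ⟨measureReal_nonneg, measureReal_le_one⟩

/-- The supremum over the model of the centred empirical process indexed by the sets
`{y | r (pbar y) (q y)}`. -/
def empiricalSup (M : Set (ℝ → ℝ)) (P : Fin n → Measure ℝ) (r : ℝ → ℝ → Prop) (pbar : ℝ → ℝ)
    (x : Fin n → ℝ) : ℝ :=
  ⨆ q : M, ∑ i, ({y | r (pbar y) (q.1 y)}.indicator (fun _ => (1 : ℝ)) (x i)
    - (P i).real {y | r (pbar y) (q.1 y)})

lemma le_empiricalSup (P : Fin n → Measure ℝ) [∀ i, IsProbabilityMeasure (P i)]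
    (r : ℝ → ℝ → Prop) (pbar : ℝ → ℝ) (x : Fin n → ℝ) {q : ℝ → ℝ} (hq : q ∈ M) :
    ∑ i, ({y | r (pbar y) (q y)}.indicator (fun _ => (1 : ℝ)) (x i)
      - (P i).real {y | r (pbar y) (q y)}) ≤ empiricalSup M P r pbar x :=
  le_ciSup (f := fun q : M => ∑ i, ({y | r (pbar y) (q.1 y)}.indicator (fun _ => (1 : ℝ)) (x i)
    - (P i).real {y | r (pbar y) (q.1 y)})) (bddAbove_range_of_abs_le (C := n) fun _ =>
      abs_sum_sub_le _ _ (fun _ => indicator_one_mem_Icc _ _)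
        fun _ => ⟨measureReal_nonneg, measureReal_le_one⟩) ⟨q, hq⟩

lemma abs_empiricalSup_le [Nonempty M] (P : Fin n → Measure ℝ)
    [∀ i, IsProbabilityMeasure (P i)] (r : ℝ → ℝ → Prop) (pbar : ℝ → ℝ) (x : Fin n → ℝ) :
    |empiricalSup M P r pbar x| ≤ n :=
  abs_ciSup_le fun _ => abs_sum_sub_le _ _ (fun _ => indicator_one_mem_Icc _ _)
    fun _ => ⟨measureReal_nonneg, measureReal_le_one⟩

/-- The only use of near-minimality: `pbar` competes both as a test against the estimate and as a
minimizer. -/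
lemma IsTVEstimator.testStat_le (hphat : IsTVEstimator M ε phat) (hMd : ∀ q ∈ M, IsDensity q)
    {pbar : ℝ → ℝ} (hpbar : pbar ∈ M) (x : Fin n → ℝ) :
    testStat x (phat x) pbar ≤ supTestStat M x pbar + ε := by
  have : Nonempty M := ⟨⟨pbar, hpbar⟩⟩
  have h1 : testStat x (phat x) pbar ≤ supTestStat M x (phat x) :=
    le_ciSup (f := fun q : M => testStat x (phat x) q.1)
      (bddAbove_range_of_abs_le fun q => abs_testStat_le (hMd _ (hphat.mem x)) x) ⟨pbar, hpbar⟩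
  have h2 : (⨅ p' : M, supTestStat M x p'.1) ≤ supTestStat M x pbar := by
    refine ciInf_le ⟨-(n : ℝ), ?_⟩ (⟨pbar, hpbar⟩ : M)
    rintro _ ⟨q, rfl⟩
    exact (abs_le.1 (abs_ciSup_le fun q' => abs_testStat_le (hMd _ q.2) x)).1
  linarith [hphat.le_iInf_add x]

lemma IsTVEstimator.mul_tvDist_le (hphat : IsTVEstimator M ε phat)
    (hMd : ∀ q ∈ M, IsDensity q) (P : Fin n → Measure ℝ) [∀ i, IsProbabilityMeasure (P i)]
    (Pm : Measure ℝ) [IsProbabilityMeasure Pm]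
    (hPm : ∀ A, MeasurableSet A → ∑ i, (P i).real A = n * Pm.real A)
    {pbar : ℝ → ℝ} (hpbar : pbar ∈ M) (x : Fin n → ℝ) :
    n * tvDist Pm (densityMeasure (phat x)) ≤ n * (3 * tvDist Pm (densityMeasure pbar))
      + (empiricalSup M P (· ≤ ·) pbar x + empiricalSup M P (· < ·) pbar x) + ε := by
  have : Nonempty M := ⟨⟨pbar, hpbar⟩⟩
  have hb := hMd _ hpbar
  have hh := hMd _ (hphat.mem x)
  have := hb.isProbabilityMeasure
  have := hh.isProbabilityMeasure
  have h0 := hphat.testStat_le hMd hpbar x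
  have hn : (0 : ℝ) ≤ n := Nat.cast_nonneg n
  have h1 : supTestStat M x pbar
      ≤ empiricalSup M P (· < ·) pbar x + n * tvDist Pm (densityMeasure pbar) := by
    refine ciSup_le fun q => ?_
    have hA : MeasurableSet {y | pbar y < q.1 y} :=
      measurableSet_lt hb.measurable (hMd _ q.2).measurable
    have e1 := le_empiricalSup P (· < ·) pbar x q.2
    have e2 := mul_le_mul_of_nonneg_left (real_sub_le_tvDist Pm (densityMeasure pbar) hA) hn
    rw [Finset.sum_sub_distrib, hPm _ hA] at e1
    rw [testStat, Finset.sum_sub_distrib]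
    simp only [Finset.sum_const, Finset.card_univ, Fintype.card_fin, nsmul_eq_mul] at e1 ⊢
    linarith
  have h2 : -empiricalSup M P (· ≤ ·) pbar x - n * tvDist Pm (densityMeasure pbar)
      + n * tvDist (densityMeasure pbar) (densityMeasure (phat x)) ≤ testStat x (phat x) pbar := by
    have hB : MeasurableSet {y | phat x y < pbar y} :=
      measurableSet_lt hh.measurable hb.measurable
    -- Passing to the complement turns the optimal set for d(pbar, phat) into one of the family
    -- {pbar ≤ q}.
    have hc : {y | pbar y ≤ phat x y} = {y | phat x y < pbar y}ᶜ := by ext; simp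
    have e1 := le_empiricalSup P (· ≤ ·) pbar x (hphat.mem x)
    rw [Finset.sum_sub_distrib, hc, hPm _ hB.compl, probReal_compl_eq_one_sub hB] at e1
    have e2 := mul_le_mul_of_nonneg_left (real_sub_le_tvDist (densityMeasure pbar) Pm hB) hn
    rw [tvDist_comm] at e2
    have e3 : ∑ i, {y | phat x y < pbar y}ᶜ.indicator (fun _ => (1 : ℝ)) (x i)
        = n - ∑ i, {y | phat x y < pbar y}.indicator (fun _ => (1 : ℝ)) (x i) := by
      rw [eq_sub_iff_add_eq, ← Finset.sum_add_distrib]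
      calc _ = ∑ i : Fin n, (1 : ℝ) := Finset.sum_congr rfl fun i _ => by
            by_cases hi : x i ∈ {y | phat x y < pbar y}
            · rw [Set.indicator_of_mem hi, Set.indicator_of_notMem (Set.notMem_compl_iff.2 hi),
                zero_add]
            · rw [Set.indicator_of_notMem hi, Set.indicator_of_mem (Set.mem_compl hi), add_zero]
        _ = n := by simp
    rw [e3] at e1
    have e4 : tvDist (densityMeasure pbar) (densityMeasure (phat x))
        = (densityMeasure pbar).real {y | phat x y < pbar y}
          - (densityMeasure (phat x)).real {y | phat x y < pbar y} := by
      rw [hb.tvDist_eq hh, hb.real_sub_real_setOf_lt hh]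
    rw [e4, testStat, Finset.sum_sub_distrib]
    simp only [Finset.sum_const, Finset.card_univ, Fintype.card_fin, nsmul_eq_mul]
    linarith
  have h3 := mul_le_mul_of_nonneg_left
    (tvDist_triangle Pm (densityMeasure pbar) (densityMeasure (phat x))) hn
  linarith

end Oracle

/-! ### The risk bound over step densities -/

section Risk

variable {n : ℕ} {Ω : Type*} [MeasurableSpace Ω] (ν : Measure Ω) [IsProbabilityMeasure ν]
  {X : Fin n → Ω → ℝ}

lemma mul_meanLaw_real (hn : 1 ≤ n) (A : Set ℝ) :
    ∑ i, (ν.map (X i)).real A = n * (meanLaw ν X).real A := by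
  have hn0 : (n : ℝ) ≠ 0 := by exact_mod_cast (by omega : n ≠ 0)
  simp only [meanLaw, measureReal_ennreal_smul_apply, ENNReal.toReal_inv, ENNReal.toReal_natCast]
  rw [← mul_assoc, mul_inv_cancel₀ hn0, one_mul, Measure.real, Measure.coe_finsetSum,
    Finset.sum_apply, ENNReal.toReal_sum fun i _ => measure_ne_top _ _]
  rfl

lemma isProbabilityMeasure_meanLaw (hn : 1 ≤ n) (hX : ∀ i, Measurable (X i)) :
    IsProbabilityMeasure (meanLaw ν X) := by
  have hn0 : (n : ENNReal) ≠ 0 := by exact_mod_cast (by omega : n ≠ 0)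
  have hp : ∀ i, IsProbabilityMeasure (ν.map (X i)) := fun i =>
    Measure.isProbabilityMeasure_map (hX i).aemeasurable
  refine ⟨?_⟩
  simp [meanLaw, ENNReal.inv_mul_cancel hn0 (ENNReal.natCast_ne_top n)]

variable {k : ℕ} {M : Set (ℝ → ℝ)} {ε : ℝ} {phat : (Fin n → ℝ) → ℝ → ℝ}

lemma IsTVEstimator.measurable_tvDist (hphat : IsTVEstimator M ε phat) (hMc : M.Countable)
    (hMd : ∀ q ∈ M, IsDensity q) (P : Measure ℝ) [IsProbabilityMeasure P]
    (hX : ∀ i, Measurable (X i)) :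
    Measurable fun ω => tvDist P (densityMeasure (phat fun i => X i ω)) :=
  TVMonotone.measurable_tvDist P hMc hMd (hphat.measurable.comp (measurable_pi_lambda _ hX))
    fun _ => hphat.mem _

lemma integral_empiricalSup_le (hMc : M.Countable) (hMd : M ⊆ monotoneDensities k) (hk : 2 ≤ k)
    {D : ℕ} {pbar : ℝ → ℝ} (hpM : pbar ∈ M) (hp : pbar ∈ stepDensities D k)
    (P : Fin n → Measure ℝ) [∀ i, IsProbabilityMeasure (P i)] {r : ℝ → ℝ → Prop}
    (hr : r = (· < ·) ∨ r = (· ≤ ·)) :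
    Measurable (empiricalSup M P r pbar) ∧
    ∫ x, empiricalSup M P r pbar x ∂Measure.pi P ≤ 6 * Real.sqrt (n * (D + k + 1)) := by
  have : Countable M := hMc.to_subtype
  have : Nonempty M := ⟨⟨pbar, hpM⟩⟩
  obtain ⟨B, hB, hBp⟩ := hp.2
  choose A hA hAq using fun q : M => (hMd q.2).2
  have hm : ∀ q : M, MeasurableSet {y | r (pbar y) (q.1 y)} := fun q => by
    have h1 := (hMd hpM).1.measurable
    have h2 := (hMd q.2).1.measurable
    rcases hr with rfl | rfl
    · exact measurableSet_lt h1 h2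
    · exact measurableSet_le h1 h2
  refine ⟨measurable_iSup_empirical hm _, ?_⟩
  refine (integral_iSup_empirical_le_sqrt P hm (c := fun q => cellLabel (A q ∪ B))
    (m := 2 * (D + k) + 1) (fun q => cellLabel_mono _) (fun q y => ?_) fun q => ?_).trans ?_
  · refine (cellLabel_lt _ y).trans_le ?_
    have h1 := Finset.card_union_le (A q) B
    have h2 := (hA q).2
    have h3 := hB.2
    omega
  · have := isConvexOnCells_lt_and_le (hA q).1 hB.1 (hAq q) hBp
    rcases hr with rfl | rfl
    · exact this.1
    · exact this.2
  -- With s = D + k, this is 16(2s + 1) ≤ 36(s + 1).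
  · have h4 : (4 : ℝ) = Real.sqrt 16 := by
      rw [show (16 : ℝ) = 4 ^ 2 by norm_num, Real.sqrt_sq (by norm_num)]
    have h6 : (6 : ℝ) = Real.sqrt 36 := by
      rw [show (36 : ℝ) = 6 ^ 2 by norm_num, Real.sqrt_sq (by norm_num)]
    rw [h4, h6, ← Real.sqrt_mul (by norm_num), ← Real.sqrt_mul (by norm_num)]
    apply Real.sqrt_le_sqrt
    push_cast
    have : (0 : ℝ) ≤ n := Nat.cast_nonneg n
    have : (0 : ℝ) ≤ n * (D + k) := by positivity
    nlinarith

/-- The risk bound with respect to a step density of the model. -/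
lemma integral_tvDist_le_of_mem (hn : 1 ≤ n) (hk : 2 ≤ k) (hMc : M.Countable)
    (hMd : M ⊆ monotoneDensities k) (hphat : IsTVEstimator M ε phat)
    (hX : ∀ i, Measurable (X i)) (hindep : iIndepFun X ν) {D : ℕ} {pbar : ℝ → ℝ}
    (hpM : pbar ∈ M) (hp : pbar ∈ stepDensities D k) :
    ∫ ω, tvDist (meanLaw ν X) (densityMeasure (phat fun i => X i ω)) ∂ν
      ≤ 3 * tvDist (meanLaw ν X) (densityMeasure pbar)
        + 12 * Real.sqrt ((D + k + 1) / n) + ε / n := by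
  have hPm := isProbabilityMeasure_meanLaw ν hn hX
  have hP : ∀ i, IsProbabilityMeasure (ν.map (X i)) := fun i =>
    Measure.isProbabilityMeasure_map (hX i).aemeasurable
  have : Nonempty M := ⟨⟨pbar, hpM⟩⟩
  have hMd' : ∀ q ∈ M, IsDensity q := fun q hq => (hMd hq).1
  have hn0 : (0 : ℝ) < n := by exact_mod_cast hn
  set P := fun i => ν.map (X i)
  have hXm : Measurable fun ω i => X i ω := measurable_pi_lambda _ hX
  have hmap : ν.map (fun ω i => X i ω) = Measure.pi P :=
    (iIndepFun_iff_map_fun_eq_pi_map fun i => (hX i).aemeasurable).1 hindep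
  have hZ : ∀ r : ℝ → ℝ → Prop, (r = (· < ·) ∨ r = (· ≤ ·)) →
      Integrable (fun ω => empiricalSup M P r pbar fun i => X i ω) ν ∧
      ∫ ω, empiricalSup M P r pbar (fun i => X i ω) ∂ν ≤ 6 * Real.sqrt (n * (D + k + 1)) := by
    intro r hr
    obtain ⟨h1, h2⟩ := integral_empiricalSup_le hMc hMd hk hpM hp P hr
    refine ⟨integrable_of_abs_le (h1.comp hXm) fun ω => abs_empiricalSup_le P r pbar _, ?_⟩
    rwa [← hmap, integral_map hXm.aemeasurable h1.aestronglyMeasurable] at h2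
  obtain ⟨i1, b1⟩ := hZ (· ≤ ·) (Or.inr rfl)
  obtain ⟨i2, b2⟩ := hZ (· < ·) (Or.inl rfl)
  have hint : Integrable
      (fun ω => tvDist (meanLaw ν X) (densityMeasure (phat fun i => X i ω))) ν :=
    integrable_of_abs_le (C := 1) (hphat.measurable_tvDist hMc hMd' _ hX) fun ω => by
      have := (hMd' _ (hphat.mem fun i => X i ω)).isProbabilityMeasure
      rw [abs_of_nonneg (tvDist_nonneg _ _)]
      exact tvDist_le_one _ _
  have key : n * ∫ ω, tvDist (meanLaw ν X) (densityMeasure (phat fun i => X i ω)) ∂ν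
      ≤ n * (3 * tvDist (meanLaw ν X) (densityMeasure pbar))
        + 12 * Real.sqrt (n * (D + k + 1)) + ε := by
    rw [← integral_const_mul]
    have i12 : Integrable (fun ω => empiricalSup M P (· ≤ ·) pbar (fun i => X i ω)
        + empiricalSup M P (· < ·) pbar fun i => X i ω) ν := i1.add i2
    have i3 : Integrable (fun ω => n * (3 * tvDist (meanLaw ν X) (densityMeasure pbar))
        + (empiricalSup M P (· ≤ ·) pbar (fun i => X i ω)
          + empiricalSup M P (· < ·) pbar fun i => X i ω)) ν := (integrable_const _).add i12
    calc _ ≤ ∫ ω, (n * (3 * tvDist (meanLaw ν X) (densityMeasure pbar))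
            + (empiricalSup M P (· ≤ ·) pbar (fun i => X i ω)
              + empiricalSup M P (· < ·) pbar fun i => X i ω) + ε) ∂ν := by
          refine integral_mono (hint.const_mul _) (i3.add (integrable_const _)) fun ω => ?_
          exact hphat.mul_tvDist_le hMd' P (meanLaw ν X) (fun A _ => mul_meanLaw_real ν hn A) hpM _
      _ = n * (3 * tvDist (meanLaw ν X) (densityMeasure pbar))
            + (∫ ω, empiricalSup M P (· ≤ ·) pbar (fun i => X i ω) ∂ν
              + ∫ ω, empiricalSup M P (· < ·) pbar (fun i => X i ω) ∂ν) + ε := by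
          rw [integral_add i3 (integrable_const _), integral_add (integrable_const _) i12,
            integral_add i1 i2]
          simp
      _ ≤ _ := by linarith
  have hs : Real.sqrt (n * (D + k + 1)) = n * Real.sqrt ((D + k + 1) / n) := by
    rw [show (n : ℝ) * (D + k + 1) = n ^ 2 * ((D + k + 1) / n) by field_simp,
      Real.sqrt_mul (by positivity), Real.sqrt_sq hn0.le]
  rw [hs] at key
  have he : ε = n * (ε / n) := by field_simp
  rw [he] at key
  refine le_of_mul_le_mul_left (key.trans_eq ?_) hn0
  rw [← he]
  field_simp

/-- The risk bound with respect to an arbitrary step density. -/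
theorem integral_tvDist_le (hn : 1 ≤ n) (hk : 2 ≤ k) (hM : IsCountableModel k M)
    (hphat : IsTVEstimator M ε phat) (hX : ∀ i, Measurable (X i)) (hindep : iIndepFun X ν)
    {D : ℕ} (hD : 1 ≤ D) {q : ℝ → ℝ} (hq : q ∈ stepDensities D k) :
    ∫ ω, tvDist (meanLaw ν X) (densityMeasure (phat fun i => X i ω)) ∂ν
      ≤ 3 * tvDist (meanLaw ν X) (densityMeasure q)
        + 12 * Real.sqrt ((D + k + 1) / n) + ε / n := by
  obtain ⟨O, hOM, hO⟩ := hM.contains_dense_steps D hD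
  refine le_of_forall_pos_le_add fun δ hδ => ?_
  -- An L¹ error δ/2 is a total variation error δ/4, which the factor 3 keeps below δ.
  obtain ⟨pbar, hpO, hpq⟩ := hO.dense q hq (δ / 2) (by positivity)
  have h := integral_tvDist_le_of_mem ν hn hk hM.isCountableDenseIn.countable
    hM.isCountableDenseIn.subset hphat hX hindep (hOM hpO) (hO.subset hpO)
  have hqd := hq.1.1
  have hpd := (hO.subset hpO).1.1
  have := hqd.isProbabilityMeasure
  have := hpd.isProbabilityMeasure
  have := isProbabilityMeasure_meanLaw ν hn hX
  rw [hqd.l1Dist_eq hpd] at hpq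
  have := tvDist_triangle (meanLaw ν X) (densityMeasure q) (densityMeasure pbar)
  linarith

end Risk

/-! ### Averaging an antitone function over a partition -/

section StepAverage

/-- The average of `g` over `(t j, t (j + 1)]`. -/
def partAverage (g : ℝ → ℝ) (t : ℕ → ℝ) (j : ℕ) : ℝ :=
  (∫ x in t j..t (j + 1), g x) / (t (j + 1) - t j)

/-- The step function equal to the average of `g` over each of the first `N` parts. -/
def stepAverage (g : ℝ → ℝ) (t : ℕ → ℝ) (N : ℕ) (x : ℝ) : ℝ :=
  ∑ j ∈ Finset.range N, (Set.Ioc (t j) (t (j + 1))).indicator (fun _ => partAverage g t j) x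

variable {g : ℝ → ℝ} {t : ℕ → ℝ}

lemma exists_mem_part {N : ℕ} {x : ℝ} (hx : x ∈ Set.Ioc (t 0) (t N)) :
    ∃ j < N, x ∈ Set.Ioc (t j) (t (j + 1)) := by
  induction N with
  | zero => exact absurd hx (by simp)
  | succ N ih =>
    rcases le_or_gt x (t N) with h | h
    · obtain ⟨j, hj, hxj⟩ := ih ⟨hx.1, h⟩
      exact ⟨j, hj.trans N.lt_succ_self, hxj⟩
    · exact ⟨N, N.lt_succ_self, h, hx.2⟩

lemma le_of_mem_parts (ht : StrictMono t) {i j : ℕ} {x y : ℝ} (hxy : x ≤ y)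
    (hx : x ∈ Set.Ioc (t i) (t (i + 1))) (hy : y ∈ Set.Ioc (t j) (t (j + 1))) : i ≤ j := by
  by_contra! h
  have := ht.monotone (Nat.succ_le_of_lt h)
  exact absurd (hx.1.trans_le (hxy.trans hy.2)) (not_lt.2 this)

lemma stepAverage_eq (ht : StrictMono t) {N j : ℕ} (hj : j < N) {x : ℝ}
    (hx : x ∈ Set.Ioc (t j) (t (j + 1))) : stepAverage g t N x = partAverage g t j := by
  rw [stepAverage, Finset.sum_eq_single_of_mem j (Finset.mem_range.2 hj),
    Set.indicator_of_mem hx]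
  intro i _ hij
  refine Set.indicator_of_notMem (fun hi => hij ?_) _
  exact le_antisymm (le_of_mem_parts ht le_rfl hi hx) (le_of_mem_parts ht le_rfl hx hi)

lemma integrable_stepAverage (N : ℕ) : Integrable (stepAverage g t N) := by
  refine integrable_finsetSum _ fun j _ => ?_
  exact (integrableOn_const (by simp)).integrable_indicator measurableSet_Ioc

lemma measurable_stepAverage (N : ℕ) : Measurable (stepAverage g t N) :=
  Finset.measurable_sum _ fun _ _ => measurable_const.indicator measurableSet_Ioc

lemma partAverage_mul (ht : StrictMono t) (j : ℕ) :
    partAverage g t j * (t (j + 1) - t j) = ∫ x in t j..t (j + 1), g x :=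
  div_mul_cancel₀ _ (sub_pos.2 (ht j.lt_succ_self)).ne'

lemma mul_le_integral_part (hg : Antitone g) (ht : StrictMono t) (j : ℕ) :
    g (t (j + 1)) * (t (j + 1) - t j) ≤ ∫ x in t j..t (j + 1), g x := by
  have := intervalIntegral.integral_mono_on (μ := volume) (ht j.lt_succ_self).le
    (intervalIntegrable_const (c := g (t (j + 1)))) hg.intervalIntegrable fun x hx => hg hx.2
  rw [intervalIntegral.integral_const, smul_eq_mul] at this
  linarith

lemma le_partAverage (hg : Antitone g) (ht : StrictMono t) (j : ℕ) :
    g (t (j + 1)) ≤ partAverage g t j :=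
  (le_div_iff₀ (sub_pos.2 (ht j.lt_succ_self))).2 (mul_le_integral_part hg ht j)

lemma partAverage_le (hg : Antitone g) (ht : StrictMono t) (j : ℕ) :
    partAverage g t j ≤ g (t j) := by
  rw [partAverage, div_le_iff₀ (sub_pos.2 (ht j.lt_succ_self))]
  have := intervalIntegral.integral_mono_on (μ := volume) (ht j.lt_succ_self).le
    hg.intervalIntegrable (intervalIntegrable_const (c := g (t j))) fun x hx => hg hx.1
  rw [intervalIntegral.integral_const, smul_eq_mul] at this
  linarith

lemma antitone_partAverage (hg : Antitone g) (ht : StrictMono t) :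
    Antitone (partAverage g t) :=
  antitone_nat_of_succ_le fun j => (partAverage_le hg ht (j + 1)).trans (le_partAverage hg ht j)

lemma integral_stepAverage (hg : Antitone g) (ht : StrictMono t) (N : ℕ) :
    ∫ x in t 0..t N, stepAverage g t N x = ∫ x in t 0..t N, g x := by
  rw [← intervalIntegral.sum_integral_adjacent_intervals fun j _ => hg.intervalIntegrable,
    ← intervalIntegral.sum_integral_adjacent_intervals fun j _ =>
      (integrable_stepAverage N).intervalIntegrable]
  refine Finset.sum_congr rfl fun j hj => ?_
  rw [intervalIntegral.integral_congr_Ioo_of_le (ht j.lt_succ_self).le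
    (g := fun _ => partAverage g t j) fun x hx =>
      stepAverage_eq ht (Finset.mem_range.1 hj) (Set.Ioo_subset_Ioc_self hx),
    intervalIntegral.integral_const, smul_eq_mul, mul_comm, partAverage_mul ht]

/-- On each part both `g` and its average lie between the two endpoint values of `g`. -/
lemma integral_abs_sub_stepAverage_le (hg : Antitone g) (ht : StrictMono t) (N : ℕ) :
    ∫ x in t 0..t N, |g x - stepAverage g t N x|
      ≤ ∑ j ∈ Finset.range N, (t (j + 1) - t j) * (g (t j) - g (t (j + 1))) := by
  have hi : ∀ u v : ℝ, IntervalIntegrable (fun x => |g x - stepAverage g t N x|) volume u v :=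
    fun u v => (hg.intervalIntegrable.sub (integrable_stepAverage N).intervalIntegrable).abs
  rw [← intervalIntegral.sum_integral_adjacent_intervals fun j _ => hi _ _]
  refine Finset.sum_le_sum fun j hj => ?_
  have := intervalIntegral.integral_mono_on_of_le_Ioo (μ := volume) (ht j.lt_succ_self).le
    (hi (t j) (t (j + 1))) (intervalIntegrable_const (c := g (t j) - g (t (j + 1)))) fun x hx => by
      rw [stepAverage_eq ht (Finset.mem_range.1 hj) (Set.Ioo_subset_Ioc_self hx), abs_le]
      have h1 := le_partAverage hg ht j
      have h2 := partAverage_le hg ht j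
      have h3 := hg hx.1.le
      have h4 := hg hx.2.le
      constructor <;> linarith
  rwa [intervalIntegral.integral_const, smul_eq_mul] at this

/-- By Abel summation the left side is the lower Riemann sum of `g`. -/
lemma sum_mul_sub_add_le_integral (hg : Antitone g) (ht : StrictMono t) (N : ℕ) :
    ∑ j ∈ Finset.range N, (t j - t 0) * (g (t j) - g (t (j + 1))) + (t N - t 0) * g (t N)
      ≤ ∫ x in t 0..t N, g x := by
  induction N with
  | zero => simp
  | succ N ih =>
    rw [Finset.sum_range_succ, ← intervalIntegral.integral_add_adjacent_intervals
      (hg.intervalIntegrable (a := t 0) (b := t N)) hg.intervalIntegrable]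
    have := mul_le_integral_part hg ht N
    linarith

/-- The error of averaging over a partition whose parts have geometrically increasing lengths. -/
lemma integral_abs_sub_stepAverage_le_of_geometric (hg : Antitone g) (ht : StrictMono t) (N : ℕ)
    (hg0 : 0 ≤ g (t N)) {V η : ℝ} (hV : 0 < V) (hη : 0 ≤ η) (hgV : g (t 0) - g (t N) ≤ V)
    (hlen : ∀ j, t (j + 1) - t j = η * (1 / V + (t j - t 0))) :
    ∫ x in t 0..t N, |g x - stepAverage g t N x| ≤ η * (1 + ∫ x in t 0..t N, g x) := by
  refine (integral_abs_sub_stepAverage_le hg ht N).trans ?_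
  have h1 := sum_mul_sub_add_le_integral hg ht N
  have h2 : 0 ≤ (t N - t 0) * g (t N) :=
    mul_nonneg (sub_nonneg.2 (ht.monotone (Nat.zero_le N))) hg0
  -- The 1/V part of the lengths leaves a telescoping sum of drops, at most V; the part t j - t 0
  -- leaves the sum bounded by the integral in `h1`.
  have h3 : ∑ j ∈ Finset.range N, (g (t j) - g (t (j + 1))) = g (t 0) - g (t N) :=
    Finset.sum_range_sub' (fun j => g (t j)) N
  have h4 : ∑ j ∈ Finset.range N, (t (j + 1) - t j) * (g (t j) - g (t (j + 1)))
      = η * ((g (t 0) - g (t N)) / V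
        + ∑ j ∈ Finset.range N, (t j - t 0) * (g (t j) - g (t (j + 1)))) := by
    rw [← h3, Finset.sum_div, ← Finset.sum_add_distrib, Finset.mul_sum]
    refine Finset.sum_congr rfl fun j _ => ?_
    rw [hlen j]
    ring
  rw [h4]
  have h5 : (g (t 0) - g (t N)) / V ≤ 1 := (div_le_one hV).2 hgV
  gcongr
  linarith

end StepAverage

/-! ### Approximation of a monotone density on an interval -/

/-- `q` is constant on every closed interval without a point of `A`. -/
def IsStepWith (A : Finset ℝ) (q : ℝ → ℝ) : Prop :=
  ∀ x y, x ≤ y → (∀ c ∈ A, c ∉ Set.Icc x y) → q x = q y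

lemma integral_indicator_Ioo {a b : ℝ} (hab : a ≤ b) (F : ℝ → ℝ) :
    ∫ x, (Set.Ioo a b).indicator F x = ∫ x in a..b, F x := by
  rw [integral_indicator measurableSet_Ioo, intervalIntegral.integral_of_le hab,
    integral_Ioc_eq_integral_Ioo]

/-- The average of an antitone density over a partition of its support is an antitone density. -/
lemma stepAverage_isDensity {a b : ℝ} (hab : a < b) {f g : ℝ → ℝ} (hf : IsDensity f)
    (hfg : f = (Set.Ioo a b).indicator g) (hg : Antitone g) (hg0 : ∀ x, 0 ≤ g x) {t : ℕ → ℝ}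
    (ht : StrictMono t) {N : ℕ} (h0 : t 0 = a) (hN : t N = b) :
    ∃ q : ℝ → ℝ, ∃ A : Finset ℝ, IsDensity q ∧ (∀ y, y ∉ Set.Ioo a b → q y = 0) ∧
      AntitoneOn q (Set.Ioo a b) ∧ a ∈ A ∧ b ∈ A ∧ A.card ≤ N + 1 ∧ IsStepWith A q ∧
      l1Dist f q = ∫ x in a..b, |g x - stepAverage g t N x| := by
  have hpart : ∀ x ∈ Set.Ioo a b, ∃ j < N, x ∈ Set.Ioc (t j) (t (j + 1)) := fun x hx =>
    exists_mem_part (by rw [h0, hN]; exact Set.Ioo_subset_Ioc_self hx)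
  have hc0 : ∀ j, 0 ≤ partAverage g t j := fun j => (hg0 _).trans (le_partAverage hg ht j)
  have hmem : ∀ j, j ≤ N → t j ∈ (Finset.range (N + 1)).image t := fun j hj =>
    Finset.mem_image_of_mem _ (Finset.mem_range.2 (Nat.lt_succ_of_le hj))
  have hint : ∫ x in a..b, g x = 1 := by
    rw [← integral_indicator_Ioo hab.le, ← hfg, hf.integral_eq_one]
  refine ⟨(Set.Ioo a b).indicator (stepAverage g t N), (Finset.range (N + 1)).image t, ?_,
    fun y hy => Set.indicator_of_notMem hy _, ?_, ?_, ?_, ?_, ?_, ?_⟩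
  · refine isDensity_of_integral_eq_one ((measurable_stepAverage N).indicator measurableSet_Ioo)
      (fun x => Set.indicator_nonneg (fun y _ => Finset.sum_nonneg fun j _ =>
        Set.indicator_nonneg (fun _ _ => hc0 j) y) x)
      ((integrable_stepAverage N).indicator measurableSet_Ioo) ?_
    rw [integral_indicator_Ioo hab.le, ← hint, ← h0, ← hN, integral_stepAverage hg ht]
  · intro x hx y hy hxy
    obtain ⟨i, hi, hxi⟩ := hpart x hx
    obtain ⟨j, hj, hyj⟩ := hpart y hy
    rw [Set.indicator_of_mem hx, Set.indicator_of_mem hy, stepAverage_eq ht hi hxi,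
      stepAverage_eq ht hj hyj]
    exact antitone_partAverage hg ht (le_of_mem_parts ht hxy hxi hyj)
  · exact h0 ▸ hmem 0 (Nat.zero_le _)
  · exact hN ▸ hmem N le_rfl
  · exact Finset.card_image_le.trans (by simp)
  · intro x y hxy hA
    have ha := hA a (h0 ▸ hmem 0 (Nat.zero_le _))
    have hb := hA b (hN ▸ hmem N le_rfl)
    simp only [Set.mem_Icc, not_and, not_le] at ha hb
    by_cases hx : x ∈ Set.Ioo a b
    · have hy : y ∈ Set.Ioo a b := ⟨hx.1.trans_le hxy, hb hx.2.le⟩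
      obtain ⟨j, hj, hxj⟩ := hpart x hx
      have hyj : y ≤ t (j + 1) := by
        by_contra! h
        exact hA _ (hmem (j + 1) hj) ⟨hxj.2, h.le⟩
      rw [Set.indicator_of_mem hx, Set.indicator_of_mem hy, stepAverage_eq ht hj hxj,
        stepAverage_eq ht hj ⟨hxj.1.trans_le hxy, hyj⟩]
    · have hy : y ∉ Set.Ioo a b := fun hy => hx ⟨by
        by_contra! h
        exact absurd (ha h) (not_lt.2 hy.1.le), hxy.trans_lt hy.2⟩
      rw [Set.indicator_of_notMem hx, Set.indicator_of_notMem hy]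
  · rw [l1Dist, hfg, ← integral_indicator_Ioo hab.le]
    congr 1
    ext x
    by_cases hx : x ∈ Set.Ioo a b
    · simp only [Set.indicator_of_mem hx]
    · simp only [Set.indicator_of_notMem hx, sub_zero, abs_zero]

lemma l1Dist_le_two {p q : ℝ → ℝ} (hp : IsDensity p) (hq : IsDensity q) : l1Dist p q ≤ 2 := by
  have := hp.isProbabilityMeasure
  rw [hp.l1Dist_eq hq]
  linarith [tvDist_le_one (densityMeasure p) (densityMeasure q)]

/-- The variation of `f` on `(a, b)`. -/
def variationOn (f : ℝ → ℝ) (a b : ℝ) : ℝ :=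
  sSup (f '' Set.Ioo a b) - sInf (f '' Set.Ioo a b)

/-- Birgé's approximation of a bounded antitone density on an interval by a step density. -/
lemma exists_step_approx_antitone {a b : ℝ} (hab : a < b) {f : ℝ → ℝ} (hf : IsDensity f)
    (hf0 : ∀ y, y ∉ Set.Ioo a b → f y = 0) (hanti : AntitoneOn f (Set.Ioo a b))
    (hbdd : BddAbove (f '' Set.Ioo a b)) {N : ℕ} (hN : 1 ≤ N) :
    ∃ q : ℝ → ℝ, ∃ A : Finset ℝ, IsDensity q ∧ (∀ y, y ∉ Set.Ioo a b → q y = 0) ∧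
      AntitoneOn q (Set.Ioo a b) ∧ a ∈ A ∧ b ∈ A ∧ A.card ≤ N + 1 ∧ IsStepWith A q ∧
      l1Dist f q ≤ 4 * (Real.log (1 + (b - a) * variationOn f a b) / N) := by
  have hne : (f '' Set.Ioo a b).Nonempty := (Set.nonempty_Ioo.2 hab).image f
  have hbelow : BddBelow (f '' Set.Ioo a b) := ⟨0, by rintro _ ⟨x, -, rfl⟩; exact hf.nonneg x⟩
  obtain ⟨S, hS⟩ : ∃ S, S = sSup (f '' Set.Ioo a b) := ⟨_, rfl⟩
  obtain ⟨m, hm⟩ : ∃ m, m = sInf (f '' Set.Ioo a b) := ⟨_, rfl⟩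
  have hfS : ∀ x ∈ Set.Ioo a b, f x ≤ S := fun x hx =>
    hS ▸ le_csSup hbdd (Set.mem_image_of_mem f hx)
  have hfm : ∀ x ∈ Set.Ioo a b, m ≤ f x := fun x hx =>
    hm ▸ csInf_le hbelow (Set.mem_image_of_mem f hx)
  have hm0 : 0 ≤ m := hm ▸ le_csInf hne (by rintro _ ⟨x, -, rfl⟩; exact hf.nonneg x)
  have hmid : (a + b) / 2 ∈ Set.Ioo a b := ⟨by linarith, by linarith⟩
  have hmS : m ≤ S := (hfm _ hmid).trans (hfS _ hmid)
  have hNpos : (0 : ℝ) < N := by exact_mod_cast hN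
  rw [variationOn, ← hS, ← hm]
  -- With zero variation the partition, which divides by V, is unavailable; `f` is then itself a
  -- step density.
  rcases hmS.eq_or_lt with hmS | hmS
  · have hconst : ∀ x ∈ Set.Ioo a b, f x = m := fun x hx =>
      le_antisymm ((hfS x hx).trans_eq hmS.symm) (hfm x hx)
    refine ⟨f, {a, b}, hf, hf0, hanti, by simp, by simp, Finset.card_le_two.trans (by omega), ?_,
      by simp [l1Dist, hmS]⟩
    intro x y hxy hA
    have ha := hA a (by simp)
    have hb := hA b (by simp)
    simp only [Set.mem_Icc, not_and, not_le] at ha hb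
    by_cases hx : x ∈ Set.Ioo a b
    · rw [hconst x hx, hconst y ⟨hx.1.trans_le hxy, hb hx.2.le⟩]
    · have hy : y ∉ Set.Ioo a b := fun hy => hx ⟨by
        by_contra! h
        exact absurd (ha h) (not_lt.2 hy.1.le), hxy.trans_lt hy.2⟩
      rw [hf0 x hx, hf0 y hy]
  set V := S - m with hV
  have hVpos : 0 < V := sub_pos.2 hmS
  have hL : 0 < b - a := sub_pos.2 hab
  have hLV : 0 < (b - a) * V := mul_pos hL hVpos
  set ℓ := Real.log (1 + (b - a) * V) / N with hℓ
  have hℓpos : 0 < ℓ := div_pos (Real.log_pos (by linarith)) hNpos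
  set ρ := Real.exp ℓ with hρ
  have hρ1 : 1 < ρ := Real.one_lt_exp_iff.2 hℓpos
  have hρN : ρ ^ N = 1 + (b - a) * V := by
    rw [hρ, ← Real.exp_nat_mul, hℓ, mul_div_cancel₀ _ hNpos.ne', Real.exp_log (by linarith)]
  -- An antitone extension to the line whose endpoint values are the extreme values of `f`, so its
  -- total drop on [a, b] is exactly V.
  let g : ℝ → ℝ := fun x => if x ≤ a then S else if x < b then f x else m
  have hg : Antitone g := by
    intro x y hxy
    simp only [g]
    split_ifs
    all_goals first
      | linarith
      | exact hfS y ⟨not_le.1 ‹¬y ≤ a›, ‹y < b›⟩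
      | exact hanti ⟨not_le.1 ‹¬x ≤ a›, ‹x < b›⟩ ⟨not_le.1 ‹¬y ≤ a›, ‹y < b›⟩ hxy
      | exact hfm x ⟨not_le.1 ‹¬x ≤ a›, ‹x < b›⟩
  have hga : g a = S := by simp [g]
  have hgb : g b = m := by simp [g, hab]
  have hg0 : ∀ x, 0 ≤ g x := fun x => by
    simp only [g]
    split_ifs
    · linarith
    · exact hf.nonneg x
    · exact hm0
  have hfg : f = (Set.Ioo a b).indicator g := by
    ext x
    by_cases hx : x ∈ Set.Ioo a b
    · rw [Set.indicator_of_mem hx]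
      simp only [g, not_le.2 hx.1, hx.2, if_true, if_false]
    · rw [Set.indicator_of_notMem hx, hf0 x hx]
  -- Geometric parts with ratio ρ; the choice ρ^N = 1 + (b - a)V makes the last point b.
  let t : ℕ → ℝ := fun j => a + (ρ ^ j - 1) / V
  have ht : StrictMono t := fun i j hij => by
    have := pow_lt_pow_right₀ hρ1 hij
    simp only [t]
    gcongr
  have ht0 : t 0 = a := by simp [t]
  have htN : t N = b := by
    simp only [t]
    rw [hρN]
    field_simp
    ring
  obtain ⟨q, A, hq, hq0, hqa, haA, hbA, hcard, hstep, herr⟩ :=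
    stepAverage_isDensity hab hf hfg hg hg0 ht ht0 htN
  refine ⟨q, A, hq, hq0, hqa, haA, hbA, hcard, hstep, ?_⟩
  -- For ℓ ≤ 1 the error 2(ρ - 1) is at most 4ℓ because e^ℓ - 1 ≤ 2ℓ; for ℓ > 1 the trivial bound 2
  -- suffices.
  rcases le_or_gt ℓ 1 with hℓ1 | hℓ1
  · have h1 := integral_abs_sub_stepAverage_le_of_geometric hg ht N (hg0 _) hVpos
      (sub_nonneg.2 hρ1.le) (by rw [ht0, htN, hga, hgb]) (fun j => by
        simp only [t]
        field_simp
        ring)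
    have hint : ∫ x in a..b, g x = 1 := by
      rw [← integral_indicator_Ioo hab.le, ← hfg, hf.integral_eq_one]
    rw [ht0, htN, ← herr, hint] at h1
    have h2 := Real.abs_exp_sub_one_le (x := ℓ) (by rwa [abs_of_pos hℓpos])
    rw [abs_of_pos hℓpos, ← hρ, abs_of_pos (sub_pos.2 hρ1)] at h2
    linarith
  · linarith [l1Dist_le_two hf hq]

lemma IsDensity.comp_neg {f : ℝ → ℝ} (hf : IsDensity f) : IsDensity fun x => f (-x) :=
  isDensity_of_integral_eq_one (hf.measurable.comp measurable_neg) (fun _ => hf.nonneg _)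
    hf.integrable.comp_neg (by rw [integral_neg_eq_self f, hf.integral_eq_one])

lemma image_comp_neg_Ioo (f : ℝ → ℝ) (a b : ℝ) :
    (fun x => f (-x)) '' Set.Ioo (-b) (-a) = f '' Set.Ioo a b := by
  ext y
  constructor
  · rintro ⟨x, hx, rfl⟩
    exact ⟨-x, ⟨by linarith [hx.2], by linarith [hx.1]⟩, rfl⟩
  · rintro ⟨x, hx, rfl⟩
    exact ⟨-x, ⟨by linarith [hx.2], by linarith [hx.1]⟩, by simp⟩

lemma neg_mem_Ioo_neg {a b x : ℝ} : -x ∈ Set.Ioo (-b) (-a) ↔ x ∈ Set.Ioo a b := by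
  simp only [Set.mem_Ioo, neg_lt_neg_iff]
  exact and_comm

/-- Birgé's approximation of a bounded monotone density on an interval by a step density. -/
theorem exists_step_approx {a b : ℝ} (hab : a < b) {f : ℝ → ℝ} (hf : IsDensity f)
    (hf0 : ∀ y, y ∉ Set.Ioo a b → f y = 0) (hmono : IsMonotoneOn f (Set.Ioo a b))
    (hbdd : BddAbove (f '' Set.Ioo a b)) {N : ℕ} (hN : 1 ≤ N) :
    ∃ q : ℝ → ℝ, ∃ A : Finset ℝ, IsDensity q ∧ (∀ y, y ∉ Set.Ioo a b → q y = 0) ∧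
      IsMonotoneOn q (Set.Ioo a b) ∧ a ∈ A ∧ b ∈ A ∧ A.card ≤ N + 1 ∧ IsStepWith A q ∧
      l1Dist f q ≤ 4 * (Real.log (1 + (b - a) * variationOn f a b) / N) := by
  rcases hmono with hm | hm
  · obtain ⟨q, A, hq, hq0, hqm, ha, hb, hc, hs, he⟩ := exists_step_approx_antitone
      (neg_lt_neg hab) hf.comp_neg (fun y hy => hf0 _ fun h => hy (by
        have := neg_mem_Ioo_neg.2 h
        rwa [neg_neg] at this))
      (fun x hx y hy hxy => hm (neg_mem_Ioo_neg.1 (by rwa [neg_neg]))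
        (neg_mem_Ioo_neg.1 (by rwa [neg_neg])) (neg_le_neg hxy))
      (by rwa [image_comp_neg_Ioo]) hN
    refine ⟨fun x => q (-x), A.image Neg.neg, hq.comp_neg,
      fun y hy => hq0 _ fun h => hy (neg_mem_Ioo_neg.1 h),
      Or.inl fun x hx y hy hxy => hqm (neg_mem_Ioo_neg.2 hy) (neg_mem_Ioo_neg.2 hx)
        (neg_le_neg hxy), Finset.mem_image.2 ⟨-a, hb, neg_neg a⟩,
      Finset.mem_image.2 ⟨-b, ha, neg_neg b⟩, Finset.card_image_le.trans hc, ?_, ?_⟩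
    · intro x y hxy hA
      refine (hs (-y) (-x) (neg_le_neg hxy) fun c hcA hcI => ?_).symm
      exact hA (-c) (Finset.mem_image_of_mem _ hcA)
        ⟨by linarith [hcI.2], by linarith [hcI.1]⟩
    · rw [variationOn, image_comp_neg_Ioo, neg_sub_neg] at he
      refine le_trans (le_of_eq ?_) he
      rw [l1Dist, l1Dist, ← integral_neg_eq_self]
      simp
  · obtain ⟨q, A, hq, hq0, hqm, hrest⟩ := exists_step_approx_antitone hab hf hf0 hm hbdd hN
    exact ⟨q, A, hq, hq0, Or.inr hqm, hrest⟩

/-! ### Approximation of a mixture of monotone densities -/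

section Mixture

variable {m : ℕ} {p : ℝ → ℝ}

/-- Points outside all the open intervals of a partition, or in just one of them. -/
lemma notMem_Ioo_of_ne {x : Fin (m + 1) → ℝ} (hx : StrictMono x) {i j : Fin m} (hij : j ≠ i)
    {y : ℝ} (hy : y ∈ Set.Ioo (x i.castSucc) (x i.succ)) :
    y ∉ Set.Ioo (x j.castSucc) (x j.succ) := by
  intro hy'
  rcases lt_or_gt_of_ne hij with h | h
  · have : x j.succ ≤ x i.castSucc := hx.monotone (Fin.le_def.2 (by simpa using h))
    linarith [hy.1, hy'.2]
  · have : x i.succ ≤ x j.castSucc := hx.monotone (Fin.le_def.2 (by simpa using h))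
    linarith [hy.2, hy'.1]

lemma sum_eq_of_mem_Ioo {x : Fin (m + 1) → ℝ} (hx : StrictMono x) {w : Fin m → ℝ}
    {q : Fin m → ℝ → ℝ} (hq0 : ∀ i y, y ∉ Set.Ioo (x i.castSucc) (x i.succ) → q i y = 0)
    {i : Fin m} {y : ℝ} (hy : y ∈ Set.Ioo (x i.castSucc) (x i.succ)) :
    ∑ j, w j * q j y = w i * q i y :=
  Finset.sum_eq_single i (fun j _ hj => by
    rw [hq0 j y (notMem_Ioo_of_ne hx hj hy), mul_zero]) (by simp)

lemma isDensity_sum {w : Fin m → ℝ} (hw : ∀ i, 0 ≤ w i) (hw1 : ∑ i, w i = 1)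
    {q : Fin m → ℝ → ℝ} (hq : ∀ i, IsDensity (q i)) : IsDensity fun y => ∑ i, w i * q i y := by
  have hi : ∀ i, Integrable fun y => w i * q i y := fun i => (hq i).integrable.const_mul _
  refine isDensity_of_integral_eq_one
    (Finset.measurable_sum _ fun i _ => (hq i).measurable.const_mul _)
    (fun y => Finset.sum_nonneg fun i _ => mul_nonneg (hw i) ((hq i).nonneg y))
    (integrable_finsetSum _ fun i _ => hi i) ?_
  rw [integral_finsetSum _ fun i _ => hi i]
  simp_rw [integral_const_mul, (hq _).integral_eq_one, mul_one, hw1]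

/-- A piece contains no cut point, so either it lies inside one interval, where a single term
survives, or it misses all of them and the sum vanishes. -/
lemma isMonotoneOn_sum {x : Fin (m + 1) → ℝ} (hx : StrictMono x) {w : Fin m → ℝ}
    (hw : ∀ i, 0 ≤ w i) {q : Fin m → ℝ → ℝ}
    (hq0 : ∀ i y, y ∉ Set.Ioo (x i.castSucc) (x i.succ) → q i y = 0)
    (hqm : ∀ i, IsMonotoneOn (q i) (Set.Ioo (x i.castSucc) (x i.succ))) {I : Set ℝ}
    (hI : I ∈ openPieces (Finset.univ.image x)) :
    IsMonotoneOn (fun y => ∑ i, w i * q i y) I := by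
  by_cases h : ∃ i : Fin m, ∃ y ∈ I, y ∈ Set.Ioo (x i.castSucc) (x i.succ)
  · obtain ⟨i, y, hyI, hy⟩ := h
    have hmem : ∀ j, x j ∉ I := fun j =>
      notMem_of_mem_openPieces hI (Finset.mem_image_of_mem _ (Finset.mem_univ j))
    have hoc := ordConnected_of_mem_openPieces hI
    have hsub : ∀ z ∈ I, z ∈ Set.Ioo (x i.castSucc) (x i.succ) := by
      intro z hz
      constructor
      · by_contra! hle
        exact hmem _ (hoc.out hz hyI ⟨hle, hy.1.le⟩)
      · by_contra! hle
        exact hmem _ (hoc.out hyI hz ⟨hy.2.le, hle⟩)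
    rcases hqm i with hmi | hmi
    · refine Or.inl fun u hu v hv huv => ?_
      simp only [sum_eq_of_mem_Ioo hx hq0 (hsub u hu), sum_eq_of_mem_Ioo hx hq0 (hsub v hv)]
      exact mul_le_mul_of_nonneg_left (hmi (hsub u hu) (hsub v hv) huv) (hw i)
    · refine Or.inr fun u hu v hv huv => ?_
      simp only [sum_eq_of_mem_Ioo hx hq0 (hsub u hu), sum_eq_of_mem_Ioo hx hq0 (hsub v hv)]
      exact mul_le_mul_of_nonneg_left (hmi (hsub u hu) (hsub v hv) huv) (hw i)
  · push Not at h
    have h0 : ∀ y ∈ I, ∑ i, w i * q i y = 0 := fun y hy =>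
      Finset.sum_eq_zero fun i _ => by rw [hq0 i y (h i y hy), mul_zero]
    exact Or.inl fun u hu v hv _ => by simp only [h0 u hu, h0 v hv, le_refl]

lemma IsStepWith.const_on_openPieces {A : Finset ℝ} {q : ℝ → ℝ} (h : IsStepWith A q) {I : Set ℝ}
    (hI : I ∈ openPieces A) : ∃ c : ℝ, ∀ x ∈ I, q x = c := by
  have key : ∀ x ∈ I, ∀ y ∈ I, x ≤ y → q x = q y := fun x hx y hy hxy =>
    h x y hxy fun c hc hcI =>
      notMem_of_mem_openPieces hI hc ((ordConnected_of_mem_openPieces hI).out hx hy hcI)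
  rcases I.eq_empty_or_nonempty with rfl | ⟨y, hy⟩
  · exact ⟨0, by simp⟩
  · refine ⟨q y, fun x hx => ?_⟩
    rcases le_total x y with hxy | hxy
    · exact key x hx y hy hxy
    · exact (key y hy x hx hxy).symm

/-- A mixture of bounded monotone densities is close to a step density. -/
theorem MonotoneMixture.exists_stepDensity (r : MonotoneMixture m p)
    (hp : IsDensity p) (N : Fin m → ℕ) (hN : ∀ i, 1 ≤ N i) :
    ∃ q ∈ stepDensities (∑ i, N i) (m + 2),
      l1Dist p q ≤ 4 * ∑ i, r.w i * (Real.log (1 + r.len i * r.var i) / N i) := by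
  have hlt : ∀ i : Fin m, r.x i.castSucc < r.x i.succ := fun i =>
    r.strictMono_x Fin.castSucc_lt_succ
  choose q A hq hq0 hqm ha hb hcard hstep herr using fun i =>
    exists_step_approx (hlt i) (r.isDensity_f i) (r.f_eq_zero i) (r.isMonotoneOn_f i)
      (r.bddAbove_f i) (hN i)
  have hQ : IsDensity fun y => ∑ i, r.w i * q i y := isDensity_sum r.w_nonneg r.sum_w hq
  refine ⟨fun y => ∑ i, r.w i * q i y, ⟨⟨hQ, Finset.univ.image r.x, ⟨by simp, ?_⟩,
    fun I hI => isMonotoneOn_sum r.strictMono_x r.w_nonneg hq0 hqm hI⟩, ?_⟩, ?_⟩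
  · exact Finset.card_image_le.trans (by simp)
  -- Neighbouring components share an endpoint. Dropping each left endpoint and adding x₀ back
  -- leaves at most 1 + ∑ Nᵢ points, exactly what index D = ∑ Nᵢ allows.
  · let B : Finset ℝ := insert (r.x 0)
      (Finset.univ.biUnion fun i => (A i).erase (r.x i.castSucc))
    have hBs : ∀ i : Fin m, r.x i.succ ∈ B := fun i => Finset.mem_insert_of_mem
      (Finset.mem_biUnion.2 ⟨i, Finset.mem_univ _, Finset.mem_erase.2 ⟨(hlt i).ne', hb i⟩⟩)
    have hBx : ∀ j, r.x j ∈ B := fun j => by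
      refine Fin.cases (Finset.mem_insert_self _ _) hBs j
    have hAB : ∀ i, A i ⊆ B := fun i c hc => by
      by_cases h : c = r.x i.castSucc
      · exact h ▸ hBx _
      · exact Finset.mem_insert_of_mem
          (Finset.mem_biUnion.2 ⟨i, Finset.mem_univ _, Finset.mem_erase.2 ⟨h, hc⟩⟩)
    have hBstep : IsStepWith B fun y => ∑ i, r.w i * q i y := fun u v huv h =>
      Finset.sum_congr rfl fun i _ => by
        rw [hstep i u v huv fun c hc => h c (hAB i hc)]
    refine ⟨B, ⟨⟨_, hBx 0⟩, ?_⟩, fun I hI => hBstep.const_on_openPieces hI⟩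
    refine (Finset.card_insert_le _ _).trans (Nat.succ_le_succ ?_)
    refine Finset.card_biUnion_le.trans (Finset.sum_le_sum fun i _ => ?_)
    rw [Finset.card_erase_of_mem (ha i)]
    have := hcard i
    omega
  · have hi : ∀ i, Integrable fun y => |r.f i y - q i y| := fun i =>
      ((r.isDensity_f i).integrable.sub (hq i).integrable).abs
    have hpf : p =ᵐ[volume] fun y => ∑ i, r.w i * r.f i y := by
      filter_upwards [r.ae_eq] with y hy
      rw [hy]
      refine Finset.sum_congr rfl fun i _ => ?_
      by_cases hyi : y ∈ Set.Ioo (r.x i.castSucc) (r.x i.succ)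
      · rw [Set.indicator_of_mem hyi]
      · rw [Set.indicator_of_notMem hyi, r.f_eq_zero i y hyi]
    calc l1Dist p (fun y => ∑ i, r.w i * q i y)
        ≤ ∫ y, ∑ i, r.w i * |r.f i y - q i y| := by
          refine integral_mono_ae (hp.integrable.sub hQ.integrable).abs
            (integrable_finsetSum _ fun i _ => (hi i).const_mul _) ?_
          filter_upwards [hpf] with y hy
          rw [hy, ← Finset.sum_sub_distrib]
          refine (Finset.abs_sum_le_sum_abs _ _).trans_eq (Finset.sum_congr rfl fun i _ => ?_)
          rw [← mul_sub, abs_mul, abs_of_nonneg (r.w_nonneg i)]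
      _ = ∑ i, r.w i * l1Dist (r.f i) (q i) := by
          rw [integral_finsetSum _ fun i _ => (hi i).const_mul _]
          simp_rw [integral_const_mul]
          rfl
      _ ≤ ∑ i, r.w i * (4 * (Real.log (1 + r.len i * r.var i) / N i)) :=
          Finset.sum_le_sum fun i _ => mul_le_mul_of_nonneg_left (herr i) (r.w_nonneg i)
      _ = _ := by
          rw [Finset.mul_sum]
          exact Finset.sum_congr rfl fun i _ => by ring

end Mixture

/-- The uniform density on `(0, 1]` is a step density. -/
lemma stepDensities_nonempty {D k : ℕ} (hD : 1 ≤ D) (hk : 2 ≤ k) :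
    (stepDensities D k).Nonempty := by
  let q : ℝ → ℝ := (Set.Ioc 0 1).indicator fun _ => 1
  have hq : IsDensity q := by
    refine isDensity_of_integral_eq_one (measurable_const.indicator measurableSet_Ioc)
      (Set.indicator_nonneg fun _ _ => zero_le_one)
      ((integrableOn_const (by simp)).integrable_indicator measurableSet_Ioc) ?_
    simp only [q]
    rw [integral_indicator measurableSet_Ioc]
    simp
  have hstep : IsStepWith {0, 1} q := by
    intro x y hxy hA
    have h0 := hA 0 (by simp)
    have h1 := hA 1 (by simp)
    simp only [Set.mem_Icc, not_and, not_le] at h0 h1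
    by_cases hx : x ∈ Set.Ioc (0 : ℝ) 1
    · simp only [q]
      rw [Set.indicator_of_mem hx,
        Set.indicator_of_mem (Set.mem_Ioc.2 ⟨hx.1.trans_le hxy, (h1 hx.2).le⟩)]
    · have hy : y ∉ Set.Ioc (0 : ℝ) 1 := fun hy => hx ⟨by
        by_contra! h
        exact absurd (h0 h) (not_lt.2 hy.1.le), hxy.trans hy.2⟩
      simp only [q]
      rw [Set.indicator_of_notMem hx, Set.indicator_of_notMem hy]
  refine ⟨q, ⟨hq, {0}, ⟨by simp, by simp; omega⟩, fun I hI => Or.inr fun x hx y hy hxy => ?_⟩,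
    {0, 1}, ⟨by simp, Finset.card_le_two.trans (by omega)⟩,
    fun I hI => hstep.const_on_openPieces hI⟩
  have h0 : (0 : ℝ) ∉ I := notMem_of_mem_openPieces hI (by simp)
  by_cases hyq : y ∈ Set.Ioc (0 : ℝ) 1
  · have hx0 : 0 < x := by
      by_contra! h
      exact h0 ((ordConnected_of_mem_openPieces hI).out hx hy ⟨h, hyq.1.le⟩)
    simp only [q]
    rw [Set.indicator_of_mem hyq, Set.indicator_of_mem (Set.mem_Ioc.2 ⟨hx0, hxy.trans hyq.2⟩)]
  · simp only [q]
    rw [Set.indicator_of_notMem hyq]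
    exact Set.indicator_nonneg (fun _ _ => zero_le_one) x

/-- A density with complexity less than `R` is close to step densities with a controlled number of
pieces. -/
lemma exists_stepDensity_of_cost_lt {m : ℕ} {p : ℝ → ℝ} (hp : IsDensity p)
    (r : MonotoneMixture m p) {R : ℝ} (hR : r.cost < R) {u : ℝ} (hu : 0 < u) :
    ∃ D : ℕ, m ≤ D ∧ (D : ℝ) ≤ m + R / u ∧
      ∃ q ∈ stepDensities D (m + 2), l1Dist p q ≤ 4 * u := by
  let s : Fin m → ℝ := fun i => Real.sqrt (r.w i * Real.log (1 + r.len i * r.var i))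
  have hs0 : ∀ i, 0 ≤ s i := fun i => Real.sqrt_nonneg _
  have hR0 : 0 < R := (sq_nonneg _).trans_lt hR
  have hS : ∑ i, s i ≤ Real.sqrt R := Real.le_sqrt_of_sq_le hR.le
  have hsR : 0 < Real.sqrt R := Real.sqrt_pos.2 hR0
  set l := Real.sqrt R / u with hl
  have hl0 : 0 < l := div_pos hsR hu
  -- For a fixed total, ∑ sᵢ²/Nᵢ is least when Nᵢ is proportional to sᵢ; the + 1 keeps every Nᵢ
  -- positive and costs at most m parts.
  let N : Fin m → ℕ := fun i => ⌊l * s i⌋₊ + 1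
  obtain ⟨q, hq, he⟩ := r.exists_stepDensity hp N fun i => Nat.le_add_left 1 _
  refine ⟨∑ i, N i, ?_, ?_, q, hq, he.trans ?_⟩
  · calc m = ∑ _i : Fin m, 1 := by simp
      _ ≤ _ := Finset.sum_le_sum fun i _ => Nat.le_add_left 1 _
  · push_cast
    calc ∑ i, (N i : ℝ) ≤ ∑ i, (l * s i + 1) := Finset.sum_le_sum fun i _ => by
          simp only [N]
          push_cast
          gcongr
          exact Nat.floor_le (mul_nonneg hl0.le (hs0 i))
      _ = m + l * ∑ i, s i := by
          rw [Finset.sum_add_distrib, ← Finset.mul_sum]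
          simp [add_comm]
      _ ≤ m + l * Real.sqrt R := by gcongr
      _ = m + R / u := by rw [hl, div_mul_eq_mul_div, Real.mul_self_sqrt hR0.le]
  · have h1 : ∀ i, r.w i * (Real.log (1 + r.len i * r.var i) / N i) ≤ s i / l := fun i => by
      have hN : (0 : ℝ) < N i := by simp only [N]; positivity
      have h2 : r.w i * Real.log (1 + r.len i * r.var i) ≤ s i * s i := by
        rcases le_total 0 (r.w i * Real.log (1 + r.len i * r.var i)) with h | h
        · exact (Real.mul_self_sqrt h).ge
        · exact h.trans (mul_self_nonneg _)
      have h3 : l * s i ≤ N i := by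
        simp only [N]
        push_cast
        exact (Nat.lt_floor_add_one _).le
      rw [← mul_div_assoc, div_le_div_iff₀ hN hl0]
      nlinarith [hs0 i]
    calc 4 * ∑ i, r.w i * (Real.log (1 + r.len i * r.var i) / N i)
        ≤ 4 * ∑ i, s i / l := by gcongr with i; exact h1 i
      _ = 4 * ((∑ i, s i) / l) := by rw [Finset.sum_div]
      _ ≤ 4 * (Real.sqrt R / l) := by gcongr
      _ = 4 * u := by rw [hl]; field_simp

/-! ### The two risk bounds -/

section Main

variable {n k : ℕ} {M : Set (ℝ → ℝ)} {ε : ℝ} {phat : (Fin n → ℝ) → ℝ → ℝ}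
  {Ω : Type*} [MeasurableSpace Ω] {X : Fin n → Ω → ℝ}

lemma meanLaw_eq (ν : Measure Ω) (hn : 1 ≤ n) {P : Measure ℝ} (h : ∀ i, ν.map (X i) = P) :
    meanLaw ν X = P := by
  have hn0 : (n : ENNReal) ≠ 0 := by exact_mod_cast (by omega : n ≠ 0)
  ext A _
  simp only [meanLaw, h, Finset.sum_const, Finset.card_univ, Fintype.card_fin,
    Measure.smul_apply, smul_eq_mul, nsmul_eq_mul]
  rw [← mul_assoc, ENNReal.inv_mul_cancel hn0 (ENNReal.natCast_ne_top n), one_mul]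

variable (ν : Measure Ω) [IsProbabilityMeasure ν]

lemma integrable_tvDist (hn : 1 ≤ n) (hM : IsCountableModel k M)
    (hphat : IsTVEstimator M ε phat) (hX : ∀ i, Measurable (X i)) :
    Integrable (fun ω => tvDist (meanLaw ν X) (densityMeasure (phat fun i => X i ω))) ν := by
  have := isProbabilityMeasure_meanLaw ν hn hX
  have hMd : ∀ q ∈ M, IsDensity q := fun q hq => (hM.isCountableDenseIn.subset hq).1
  refine integrable_of_abs_le (C := 1)
    (hphat.measurable_tvDist hM.isCountableDenseIn.countable hMd _ hX) fun ω => ?_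
  have := (hMd _ (hphat.mem fun i => X i ω)).isProbabilityMeasure
  rw [abs_of_nonneg (tvDist_nonneg _ _)]
  exact tvDist_le_one _ _

theorem integral_tvDist_le_iInf (hn : 1 ≤ n) (hk : 2 ≤ k) (hM : IsCountableModel k M)
    (hphat : IsTVEstimator M ε phat) (hX : ∀ i, Measurable (X i)) (hindep : iIndepFun X ν) :
    ∫ ω, tvDist (meanLaw ν X) (densityMeasure (phat fun i => X i ω)) ∂ν
      ≤ (⨅ D : {D : ℕ // 1 ≤ D},
          (3 * (⨅ q : stepDensities D.1 k, tvDist (meanLaw ν X) (densityMeasure q.1))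
            + 83.2 * Real.sqrt (((D.1 : ℝ) + k + 1) / n))) + ε / n := by
  have : Nonempty {D : ℕ // 1 ≤ D} := ⟨⟨1, le_rfl⟩⟩
  rw [← sub_le_iff_le_add]
  refine le_ciInf fun D => ?_
  -- An infimum over an empty type would be 0 by convention, hence the need for a witness.
  have : Nonempty (stepDensities D.1 k) := (stepDensities_nonempty D.2 hk).to_subtype
  rw [← sub_le_iff_le_add, ← div_le_iff₀' (by norm_num)]
  refine le_ciInf fun q => ?_
  rw [div_le_iff₀' (by norm_num)]
  have h := integral_tvDist_le ν hn hk hM hphat hX hindep D.2 q.2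
  have := Real.sqrt_nonneg (((D.1 : ℝ) + k + 1) / n)
  linarith

theorem integral_l1Dist_le (hn : 1 ≤ n) (hk : 3 ≤ k) (hM : IsCountableModel k M)
    (hphat : IsTVEstimator M ε phat) (hX : ∀ i, Measurable (X i)) (hindep : iIndepFun X ν)
    {R : ℝ} (hR : 0 < R) {p : ℝ → ℝ} (hp : p ∈ boundedMonotoneDensitiesLT k R)
    (hlaw : ∀ i, ν.map (X i) = densityMeasure p) :
    Integrable (fun ω => l1Dist p (phat fun i => X i ω)) ν ∧
      ∫ ω, l1Dist p (phat fun i => X i ω) ∂ν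
        ≤ 82.6 * (R / n) ^ (1 / 3 : ℝ) + 166.4 * Real.sqrt (2 * k / n) + 2 * ε / n := by
  have hn0 : (0 : ℝ) < n := by exact_mod_cast hn
  have hpd : IsDensity p := hp.1.1.1
  have hMd : ∀ q ∈ M, IsDensity q := fun q hq => (hM.isCountableDenseIn.subset hq).1
  have hmean : meanLaw ν X = densityMeasure p := meanLaw_eq ν hn hlaw
  have hl1 : (fun ω => l1Dist p (phat fun i => X i ω))
      = fun ω => 2 * tvDist (meanLaw ν X) (densityMeasure (phat fun i => X i ω)) := by
    ext ω
    rw [hmean, hpd.l1Dist_eq (hMd _ (hphat.mem _))]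
  rw [hl1]
  refine ⟨(integrable_tvDist ν hn hM hphat hX).const_mul 2, ?_⟩
  rw [integral_const_mul]
  have : Nonempty (MonotoneMixture (k - 2) p) := hp.1.2
  obtain ⟨r, hr⟩ := exists_lt_of_ciInf_lt hp.2
  obtain ⟨m, rfl⟩ : ∃ m, k = m + 2 := ⟨k - 2, by omega⟩
  -- With this u the extra R/u parts equal n u², so they contribute u to √(D/n), the same order as
  -- the approximation error.
  set u : ℝ := (R / n) ^ (1 / 3 : ℝ) with hu
  have hRn : 0 < R / n := div_pos hR hn0
  have hu0 : 0 < u := Real.rpow_pos_of_pos hRn _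
  have hu3 : R = n * u ^ 3 := by
    rw [hu, ← Real.rpow_natCast, ← Real.rpow_mul hRn.le]
    norm_num
    field_simp
  obtain ⟨D, hmD, hD, q, hq, hpq⟩ := exists_stepDensity_of_cost_lt (m := m) hpd r hr hu0
  have h := integral_tvDist_le ν hn (by omega) hM hphat hX hindep (by omega : 1 ≤ D) hq
  rw [hpd.l1Dist_eq hq.1.1, ← hmean] at hpq
  have hRu : R / u = n * u ^ 2 := by rw [hu3]; field_simp
  rw [hRu] at hD
  -- Since D ≤ m + n u², the numerator is at most n u² + 2m + 3 ≤ n u² + 2k. The final L¹ bound is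
  -- then 36u + 24√(2k/n), plus 2ε/n.
  have hsq : Real.sqrt ((D + (m + 2 : ℕ) + 1) / n) ≤ u + Real.sqrt (2 * (m + 2 : ℕ) / n) := by
    have hc : (0 : ℝ) ≤ 2 * (m + 2 : ℕ) / n := by positivity
    have hv := Real.sqrt_nonneg (2 * ((m + 2 : ℕ) : ℝ) / n)
    rw [Real.sqrt_le_left (by positivity)]
    have h1 : ((D : ℝ) + (m + 2 : ℕ) + 1) / n ≤ u ^ 2 + 2 * (m + 2 : ℕ) / n := by
      rw [div_le_iff₀ hn0, add_mul, div_mul_cancel₀ _ hn0.ne']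
      push_cast
      linarith
    nlinarith [Real.sq_sqrt hc]
  have hs0 := Real.sqrt_nonneg (2 * ((m + 2 : ℕ) : ℝ) / n)
  have he : 2 * ε / n = 2 * (ε / n) := by ring
  rw [he]
  linarith

end Main

end TVMonotone

end

theorem mainTheorem4 {n : ℕ} (hn : 1 ≤ n) {k : ℕ} (hk : 2 ≤ k)
    {M : Set (ℝ → ℝ)} (hM : TVMonotone.IsCountableModel k M)
    {ε : ℝ} (hε : 0 < ε)
    {phat : (Fin n → ℝ) → ℝ → ℝ} (hphat : TVMonotone.IsTVEstimator M ε phat)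
    {Ω : Type*} [MeasurableSpace Ω] (ν : Measure Ω) [IsProbabilityMeasure ν]
    (X : Fin n → Ω → ℝ) (hX : ∀ i, Measurable (X i)) (hindep : iIndepFun X ν) :
    (Integrable (fun ω => TVMonotone.tvDist (TVMonotone.meanLaw ν X)
        (TVMonotone.densityMeasure (phat (fun i => X i ω)))) ν ∧
      ∫ ω, TVMonotone.tvDist (TVMonotone.meanLaw ν X)
          (TVMonotone.densityMeasure (phat (fun i => X i ω))) ∂ν
        ≤ (⨅ D : {D : ℕ // 1 ≤ D},
            (3 * (⨅ q : TVMonotone.stepDensities D.1 k,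
                TVMonotone.tvDist (TVMonotone.meanLaw ν X) (TVMonotone.densityMeasure q.1))
              + 83.2 * Real.sqrt (((D.1 : ℝ) + k + 1) / n)))
          + ε / n) ∧
    (3 ≤ k → ∀ R : ℝ, 0 < R → ∀ p ∈ TVMonotone.boundedMonotoneDensitiesLT k R,
      (∀ i, ν.map (X i) = TVMonotone.densityMeasure p) →
      Integrable (fun ω => TVMonotone.l1Dist p (phat (fun i => X i ω))) ν ∧
      ∫ ω, TVMonotone.l1Dist p (phat (fun i => X i ω)) ∂ν
        ≤ 82.6 * (R / n) ^ (1 / 3 : ℝ) + 166.4 * Real.sqrt (2 * k / n) + 2 * ε / n) :=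
  ⟨⟨TVMonotone.integrable_tvDist ν hn hM hphat hX,
    TVMonotone.integral_tvDist_le_iInf ν hn hk hM hphat hX hindep⟩,
  fun hk3 _ hR _ hp hlaw =>
    TVMonotone.integral_l1Dist_le ν hn hk3 hM hphat hX hindep hR hp hlaw⟩
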